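/- Let $F_\bullet$ be a non-Archimedean local field of odd residual characteristic, and let $F/F_\bullet$ be a ramified quadratic extension with non-trivial automorphism $c$. For a local field $K$ write $\mathfrak o_K,\mathfrak p_K,\mathbf k_K$ for its ring of integers, maximal ideal and residue field. Let $V$ be a finite-dimensional $F$-vector space with a non-degenerate $(F/F_\bullet,\epsilon)$-Hermitian form $h$, $\epsilon=\pm1$. Put $\tilde A=\mathrm{End}_F(V)$, let $X\mapsto\bar X$ be the adjoint with respect to $h$, and put ${}^\alpha X=-\bar X$. Let $\Lambda$ be a strictly decreasing self-dual $\mathfrak o_F$-lattice chain in $V$ (the $\mathfrak p_F$-valued $h$-dual of $\Lambda(k)$ is $\Lambda(m-k)$ for a fixed $m$). For $k\in\mathbb Z$ let $\tilde{\mathfrak P}^k_\Lambda=\{X\in\tilde A: X\Lambda(i)\subseteq\Lambda(i+k)\ \forall i\}$, $\tilde{\mathfrak A}_\Lambda=\tilde{\mathfrak P}^0_\Lambda$, and let $v_\Lambda$ be the associated valuation. For a real number $t$ put $\tilde{\mathfrak P}^{t}_\Lambda=\tilde{\mathfrak P}^{\lceil t\rceil}_\Lambda$, and let $t_+$ be the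 smallest integer $>t$. Let $[\Lambda,n,0,\beta]$ be a simple stratum in $\tilde A$ (in the sense of Bushnell–Kutzko) with ${}^\alpha\beta=\beta$, and let $E=F[\beta]$; in particular $E$ is a field and $\Lambda$ is an $\mathfrak o_E$-lattice chain. Assume that $[E:F]=\dim_FV$, that $E/F$ is tamely ramified, and that $E$ is a ramified quadratic extension of its subfield $E_\bullet$ of fixed points of $-\alpha$. Let $\varpi_E$ be a uniformizer of $E$ with $\varpi_E^2=-N_{E/E_\bullet}(\varpi_E)$, and let $y\in E^\times$ be a root of unity of order prime to the residual characteristic. Let $\gamma_0=\beta,\gamma_1,\dots,\gamma_d,\gamma_{d+1}=0$ and integers $r_0<\dots<r_d=n$ be a Bushnell–Kutzko defining sequence of the stratum, with ${}^\alpha\gamma_j=\gamma_j$. That is, writing $E_j=F[\gamma_j]$ and $\tilde B_j$ for the centralizer of $E_j$ in $\tilde A$: * $[\Lambda,n,r_j,\gamma_{j+1}]$ is simple for $0\le j<d$; * $\gamma_j-\gamma_{j+1}\in\tilde{\mathfrak P}^{-r_j}_\Lambda$ for $0\le j\le d$; * the critical exponent $k_0(\gamma_j,\tilde{\mathfrak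 A}_\Lambda)$ is $-r_j$ for $j<d$, and is $-n$ or $-\infty$ for $j=d$; * for $0\le j\le d$, if $s_{j+1}:\tilde A\to\tilde B_{j+1}$ is a tame corestriction relative to $E_{j+1}/F$, then the derived stratum $[\tilde{\mathfrak A}_\Lambda\cap\tilde B_{j+1},r_j,r_j-1,s_{j+1}(\gamma_j-\gamma_{j+1})]$ is equivalent to a simple stratum. Assume moreover that $E_{j+1}\subseteq E_j$ for $0\le j\le d$. Put $c_j=\gamma_j-\gamma_{j+1}$ and $\tilde{\mathfrak P}^{t}_{\Lambda,E_j}=\tilde{\mathfrak P}^{t}_\Lambda\cap\tilde B_j$, and for $0\le j\le d$ define the $\mathbf k_F$-vector space $$\mathfrak W_{z,j}=\tilde{\mathfrak P}^{-1+(r_j/2)_+}_{\Lambda,E_{j+1}}\Big/\Big(\tilde{\mathfrak P}^{-1+(r_j/2)_+}_{\Lambda,E_j}+\tilde{\mathfrak P}^{r_j/2}_{\Lambda,E_{j+1}}\Big).$$ Then for each $j$ the formula $$D_j(X,Y)=\mathrm{tr}_{\tilde A/F}\big(y^{-1}\varpi_E\,(Xc_j-c_jX)\,{}^\alpha Y\big)\bmod\mathfrak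 p_F$$ gives a well-defined $\mathbf k_F$-bilinear form on $\mathfrak W_{z,j}$, and the orthogonal sum $D=D_0\perp\dots\perp D_d$ on $\mathfrak W_z=\bigoplus_{j=0}^d\mathfrak W_{z,j}$ is symmetric and non-degenerate, both as a bilinear form and as a quadratic form $X\mapsto D(X,X)$ (i.e. the polar form of the latter is non-degenerate). -/

import Mathlib

open ValuativeRel
open scoped DirectSum

noncomputable section

namespace StronglyRamified

/-! ### Local fields -/

/-- The ramification index `e(L/K) = [v_L(Lˣ) : v_L(Kˣ)]` of an extension of valued fields. -/
def ramIdx (K L : Type*) [Field K] [Field L] [ValuativeRel L] [Algebra K L] : ℕ :=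
  (Units.map ((valuation L).toMonoidWithZeroHom.toMonoidHom.comp
    (algebraMap K L).toMonoidHom)).range.index

/-- `⌈x₊⌉`, the smallest integer that is strictly larger than `x`. -/
def ceilPlus (x : ℚ) : ℤ := ⌊x⌋ + 1

/-! ### Sesquilinear forms and adjoints -/

section Hermitian

variable {F V : Type*} [Field F] [AddCommGroup V] [Module F V] {c : F →+* F}

/-- The adjoint `X̄` of `X` with respect to `h`, so that `h (X v) w = h v (X̄ w)`. It exists and is
unique when `h` is non-degenerate and `V` is finite-dimensional, see `apply_conjAdjoint` and
`eq_conjAdjoint` (the value `0` is used when there is no adjoint). -/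
def conjAdjoint (h : V →ₗ[F] V →ₛₗ[c] F) (X : Module.End F V) : Module.End F V :=
  open Classical in
  if hX : ∃ Y : Module.End F V, ∀ v w, h (X v) w = h v (Y w) then hX.choose else 0

/-- The anti-involution `ᵅX = -X̄`. -/
def alpha (h : V →ₗ[F] V →ₛₗ[c] F) (X : Module.End F V) : Module.End F V :=
  -conjAdjoint h X

theorem exists_conjAdjoint [FiniteDimensional F V] (h : V →ₗ[F] V →ₛₗ[c] F)
    (hc : Function.Surjective c) (hh : h.SeparatingRight) (X : Module.End F V) :
    ∃ Y : Module.End F V, ∀ v w, h (X v) w = h v (Y w) := by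
  have hinj : Function.Injective h.flip := by
    rw [← LinearMap.ker_eq_bot, LinearMap.ker_eq_bot']
    intro w hw
    exact hh w fun v => by simpa using LinearMap.congr_fun hw v
  have hsurj : Function.Surjective h.flip := by
    have : RingHomSurjective c := ⟨hc⟩
    have h1 : Module.finrank F (LinearMap.range h.flip) = Module.finrank F V := by
      let e : V ≃+ LinearMap.range h.flip :=
        AddEquiv.ofBijective ((h.flip.rangeRestrict : V →+ LinearMap.range h.flip))
          ⟨fun a b hab => hinj (congrArg Subtype.val hab), h.flip.surjective_rangeRestrict⟩
      have := lift_rank_eq_of_equiv_equiv (R := F) (R' := F) c e ⟨c.injective, hc⟩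
        (fun a v => by
          apply Subtype.ext
          exact h.flip.map_smulₛₗ a v)
      simpa [Module.finrank] using (congrArg Cardinal.toNat this).symm
    have h2 : LinearMap.range h.flip = ⊤ := by
      apply Submodule.eq_top_of_finrank_eq
      rw [h1]
      exact (Subspace.dual_finrank_eq (K := F) (V := V)).symm
    exact LinearMap.range_eq_top.mp h2
  choose Y hY using fun w => hsurj (h.flip w ∘ₗ X)
  have hY' : ∀ v w, h v (Y w) = h (X v) w := fun v w => by
    simpa using LinearMap.congr_fun (hY w) v
  refine ⟨⟨⟨Y, fun w w' => hinj ?_⟩, fun a w => hinj ?_⟩, fun v w => (hY' v w).symm⟩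
  · ext v
    simp [hY']
  · ext v
    simp [hY']

theorem apply_conjAdjoint [FiniteDimensional F V] (h : V →ₗ[F] V →ₛₗ[c] F)
    (hc : Function.Surjective c) (hh : h.SeparatingRight) (X : Module.End F V) (v w : V) :
    h (X v) w = h v (conjAdjoint h X w) := by
  have hX := exists_conjAdjoint h hc hh X
  rw [conjAdjoint, dif_pos hX]
  exact hX.choose_spec v w

theorem eq_conjAdjoint [FiniteDimensional F V] (h : V →ₗ[F] V →ₛₗ[c] F)
    (hc : Function.Surjective c) (hh : h.SeparatingRight) {X Y : Module.End F V}
    (hY : ∀ v w, h (X v) w = h v (Y w)) : Y = conjAdjoint h X := by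
  ext w
  refine sub_eq_zero.mp (hh _ fun v => ?_)
  rw [map_sub, ← hY, ← apply_conjAdjoint h hc hh, sub_self]

end Hermitian

/-! ### Lattice chains and hereditary orders -/

section Chains

variable (F V : Type*) [Field F] [ValuativeRel F] [AddCommGroup V] [Module F V]

/-- An `𝔬_F`-lattice chain in `V`: a strictly decreasing sequence of `𝔬_F`-lattices
(finitely generated submodules that span `V`) with `𝔭_F Λ(k) = Λ(k + e)` for some `e`. -/
structure LatticeChain where
  toFun : ℤ → Submodule 𝒪[F] V
  fg : ∀ k, (toFun k).FG
  span_eq_top : ∀ k, Submodule.span F (toFun k : Set V) = ⊤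
  strictAnti : StrictAnti toFun
  periodic : ∃ e : ℕ, 0 < e ∧ ∀ k, 𝓂[F] • toFun k = toFun (k + e)

variable {F V}

namespace LatticeChain

variable (L : LatticeChain F V)

/-- `𝔓^k = {X ∈ End_F(V) : X Λ(m) ⊆ Λ(m + k) for all m}`. -/
def frakP (k : ℤ) : Submodule 𝒪[F] (Module.End F V) where
  carrier := {X | ∀ m, ∀ v ∈ L.toFun m, X v ∈ L.toFun (m + k)}
  add_mem' hX hY m v hv := add_mem (hX m v hv) (hY m v hv)
  zero_mem' _ _ _ := zero_mem _
  smul_mem' a _ hX m v hv := (L.toFun (m + k)).smul_mem a (hX m v hv)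

/-- `𝔓^k ∩ B`, where `B` is the centralizer of the subalgebra `K` in `End_F(V)`. -/
def frakPCent (K : Subalgebra F (Module.End F V)) (k : ℤ) : Submodule 𝒪[F] (Module.End F V) :=
  L.frakP k ⊓
    (Subalgebra.toSubmodule (Subalgebra.centralizer F (K : Set (Module.End F V)))).restrictScalars
      𝒪[F]

/-- For a subfield `K` of `End_F(V)`: `Λ` is an `𝔬_K`-lattice chain, i.e. `Kˣ` normalizes `Λ`
(each `x ∈ Kˣ` permutes the lattices of the chain by a translation of the index). -/
def IsPure (K : Subalgebra F (Module.End F V)) : Prop :=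
  ∀ x ∈ K, x ≠ 0 → ∃ m : ℤ, ∀ k, (L.toFun k).map (x.restrictScalars 𝒪[F]) = L.toFun (k + m)

/-- The set of `k ∈ ℤ` with `{x ∈ 𝔅 : a x - x a ∈ 𝔓^k} ⊄ 𝔅_a + (𝔓 ∩ B)`, where `B` is the
centralizer of `K`, `𝔅 = 𝔓^0 ∩ B`, and `𝔅_a` is the centralizer of `a` in `𝔅`. -/
def critSet (K : Subalgebra F (Module.End F V)) (a : Module.End F V) : Set ℤ :=
  {k | ∃ x ∈ L.frakPCent K 0, a * x - x * a ∈ L.frakP k ∧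
    x ∉ L.frakPCent (K ⊔ Algebra.adjoin F {a}) 0 ⊔ L.frakPCent K 1}

/-- `k = k₀(a, 𝔅)`, the critical exponent of `a`, a maximum. (When `a ∈ K` the set is empty
and `k₀(a, 𝔅) = -∞`.) -/
def IsCriticalExponent (K : Subalgebra F (Module.End F V)) (a : Module.End F V) (k : ℤ) : Prop :=
  IsGreatest (L.critSet K a) k

/-- `[𝔅, n, r, a]` is a simple stratum in the centralizer `B` of the subfield `K`, `𝔅` being the
order of `Λ` in `B`: the algebra `K[a]` is a field whose multiplicative group normalizes `Λ`,
`v_Λ(a) = -n`, `n > r`, and `r < -k₀(a, 𝔅)`. For `K = F` it is a simple stratum in `End_F(V)`. -/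
structure IsSimpleStratum (K : Subalgebra F (Module.End F V)) (n r : ℤ) (a : Module.End F V) :
    Prop where
  mem_centralizer : a ∈ Subalgebra.centralizer F (K : Set (Module.End F V))
  isField : IsField ↥(K ⊔ Algebra.adjoin F {a})
  isPure : L.IsPure (K ⊔ Algebra.adjoin F {a})
  mem_frakP : a ∈ L.frakP (-n)
  notMem_frakP : a ∉ L.frakP (-n + 1)
  lt : r < n
  lt_neg_criticalExponent : ∀ k ∈ L.critSet K a, r < -k

end LatticeChain

/-- A tame corestriction on `End_F(V)` relative to the subfield `K` with centralizer `B`: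
a `(B, B)`-bimodule homomorphism `s : End_F(V) → B` such that `s(𝔄) = 𝔄 ∩ B` for all hereditary
orders `𝔄` normalized by `Kˣ`, i.e. for the orders of all `𝔬_K`-lattice chains in `V`. -/
structure IsTameCorestriction (K : Subalgebra F (Module.End F V))
    (s : Module.End F V →ₗ[F] Module.End F V) : Prop where
  mem_centralizer : ∀ a, s a ∈ Subalgebra.centralizer F (K : Set (Module.End F V))
  map_mul_left : ∀ b ∈ Subalgebra.centralizer F (K : Set (Module.End F V)), ∀ a,
    s (b * a) = b * s a
  map_mul_right : ∀ b ∈ Subalgebra.centralizer F (K : Set (Module.End F V)), ∀ a,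
    s (a * b) = s a * b
  map_order : ∀ L : LatticeChain F V, L.IsPure K →
    (L.frakP 0).map (s.restrictScalars 𝒪[F]) = L.frakPCent K 0

end Chains

/-! ### Approximation of a simple stratum -/

section Sequence

variable {F E V : Type*} [Field F] [ValuativeRel F] [Field E] [Algebra F E]
  [AddCommGroup V] [Module F V] [Module E V] [IsScalarTower F E V]

variable (F V) in
/-- The embedding of `E` into `End_F(V)` for an `E`-vector space `V`. -/
def emb : E →ₐ[F] Module.End F V := Algebra.lsmul F F V

variable (F V) in
/-- The subfield `F[γ]` of `End_F(V)`, for `γ ∈ E`. -/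
def fieldOf (γ : E) : Subalgebra F (Module.End F V) := Algebra.adjoin F {emb F V γ}

/-- A sequence of strata `[Λ, n, r_j, γ_{j+1}]`, `0 ≤ j ≤ d`, with `γ_0 = β` and `γ_{d+1} = 0`, that
approximates the simple stratum `[Λ, n, 0, β]`, whose critical exponents are the `r_j`.
All `γ_j` lie in `E`, and the fields `E_j = F[γ_j]` form a decreasing tower. -/
structure IsApproximation (L : LatticeChain F V) (n : ℤ) (β : E) {d : ℕ}
    (γ : Fin (d + 2) → E) (r : Fin (d + 1) → ℤ) : Prop where
  zero : γ 0 = β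
  last : γ (Fin.last (d + 1)) = 0
  strictMono : StrictMono r
  r_last : r (Fin.last d) = n
  /-- `[Λ, n, r_j, γ_{j+1}]` is simple for `j < d` (for `j = d` it is the stratum
  `[Λ, n, n, 0]`). -/
  simple : ∀ j : Fin d, L.IsSimpleStratum ⊥ n (r j.castSucc) (emb F V (γ j.succ.castSucc))
  /-- `[Λ, n, r_j, γ_{j+1}]` is equivalent to `[Λ, n, r_j, γ_j]`. -/
  equiv : ∀ j : Fin (d + 1), emb F V (γ j.castSucc - γ j.succ) ∈ L.frakP (-(r j))
  /-- `r_j = -k₀(γ_j, 𝔄)` for `j < d`. -/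
  crit : ∀ j : Fin d,
    L.IsCriticalExponent ⊥ (emb F V (γ j.castSucc.castSucc)) (-(r j.castSucc))
  /-- `k₀(γ_d, 𝔄)` is `-n` or `-∞`. -/
  crit_last : γ (Fin.last d).castSucc ∈ (algebraMap F E).range ∨
    L.IsCriticalExponent ⊥ (emb F V (γ (Fin.last d).castSucc)) (-n)
  /-- The derived stratum `[𝔅_{j+1}, r_j, r_j - 1, s_{j+1}(γ_j - γ_{j+1})]` is equivalent to a
  simple stratum `[𝔅_{j+1}, r_j, r_j - 1, δ_j]`. -/
  derived : ∀ j : Fin (d + 1), ∃ (s : Module.End F V →ₗ[F] Module.End F V) (δ : Module.End F V),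
    IsTameCorestriction (fieldOf F V (γ j.succ)) s ∧
    L.IsSimpleStratum (fieldOf F V (γ j.succ)) (r j) (r j - 1) δ ∧
    s (emb F V (γ j.castSucc - γ j.succ)) - δ ∈ L.frakP (-(r j - 1))
  tower : ∀ j : Fin (d + 1), Algebra.adjoin F {γ j.succ} ≤ Algebra.adjoin F {γ j.castSucc}

end Sequence

/-! ### The spaces `𝔚_{z,j}` and the forms `D_j` -/

section Form

variable {F V : Type*} [Field F] [ValuativeRel F] [AddCommGroup V] [Module F V]

/-- The numerator `𝔓^{-1+(r/2)₊} ∩ B'`, with `B'` the centralizer of `K'`. -/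
def wNum (L : LatticeChain F V) (K' : Subalgebra F (Module.End F V)) (r : ℤ) :
    Submodule 𝒪[F] (Module.End F V) :=
  L.frakPCent K' (-1 + ceilPlus ((r : ℚ) / 2))

/-- The denominator `𝔓^{-1+(r/2)₊} ∩ B + 𝔓^{r/2} ∩ B'`, with `B`, `B'` the centralizers of
`K`, `K'`. -/
def wDen (L : LatticeChain F V) (K K' : Subalgebra F (Module.End F V)) (r : ℤ) :
    Submodule 𝒪[F] (Module.End F V) :=
  L.frakPCent K (-1 + ceilPlus ((r : ℚ) / 2)) ⊔ L.frakPCent K' ⌈(r : ℚ) / 2⌉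

/-- The quotient `𝔓^{-1+(r/2)₊} ∩ B' / (𝔓^{-1+(r/2)₊} ∩ B + 𝔓^{r/2} ∩ B')`. With `K = E_j`,
`K' = E_{j+1}` and `r = r_j` it is `𝔚_{z,j}`. -/
def W (L : LatticeChain F V) (K K' : Subalgebra F (Module.End F V)) (r : ℤ) : Type _ :=
  ↥(wNum L K' r) ⧸ (wDen L K K' r).submoduleOf (wNum L K' r)

instance (L : LatticeChain F V) (K K' : Subalgebra F (Module.End F V)) (r : ℤ) :
    AddCommGroup (W L K K' r) :=
  inferInstanceAs (AddCommGroup (↥(wNum L K' r) ⧸ (wDen L K K' r).submoduleOf (wNum L K' r)))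

instance (L : LatticeChain F V) (K K' : Subalgebra F (Module.End F V)) (r : ℤ) :
    Module 𝒪[F] (W L K K' r) :=
  inferInstanceAs (Module 𝒪[F] (↥(wNum L K' r) ⧸ (wDen L K K' r).submoduleOf (wNum L K' r)))

/-- The class in `W` of an element of the numerator. -/
def W.mk (L : LatticeChain F V) (K K' : Subalgebra F (Module.End F V)) (r : ℤ) :
    ↥(wNum L K' r) →ₗ[𝒪[F]] W L K K' r :=
  ((wDen L K K' r).submoduleOf (wNum L K' r)).mkQ

theorem smul_mem_frakP (L : LatticeChain F V) {a : 𝒪[F]} (ha : a ∈ 𝓂[F]) {k l : ℤ}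
    (hkl : l ≤ k + 1) {X : Module.End F V} (hX : X ∈ L.frakP k) : a • X ∈ L.frakP l := by
  intro m v hv
  obtain ⟨e, he, hper⟩ := L.periodic
  have h1 : a • X v ∈ L.toFun (m + k + e) := by
    rw [← hper]
    exact Submodule.smul_mem_smul ha (hX m v hv)
  exact L.strictAnti.antitone (by omega) h1

theorem W.isTorsionBySet (L : LatticeChain F V) (K K' : Subalgebra F (Module.End F V)) (r : ℤ) :
    Module.IsTorsionBySet 𝒪[F] (W L K K' r) (𝓂[F] : Set 𝒪[F]) := by
  intro x a
  obtain ⟨X, rfl⟩ := Submodule.mkQ_surjective _ x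
  have hle : ⌈(r : ℚ) / 2⌉ ≤ (-1 + ceilPlus ((r : ℚ) / 2)) + 1 := by
    have := Int.ceil_le_floor_add_one ((r : ℚ) / 2)
    unfold ceilPlus
    omega
  refine (Submodule.Quotient.mk_eq_zero _).mpr
    (Submodule.mem_sup_right ⟨smul_mem_frakP L a.2 hle X.2.1, ?_⟩)
  exact ((Subalgebra.toSubmodule (Subalgebra.centralizer F
    (K' : Set (Module.End F V)))).restrictScalars 𝒪[F]).smul_mem a.1 X.2.2

/-- The `𝐤_F`-vector space structure on `W` induced by its `𝔬_F`-module structure. -/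
instance (L : LatticeChain F V) (K K' : Subalgebra F (Module.End F V)) (r : ℤ) :
    Module 𝓀[F] (W L K K' r) :=
  Module.IsTorsionBySet.module (W.isTorsionBySet L K K' r)

variable {c : F →+* F}

/-- `D` is the form `D(X, Y) = tr(u (X c₀ - c₀ X) ᵅY) mod 𝔭_F` on `W`. -/
def IsTraceForm (L : LatticeChain F V) (K K' : Subalgebra F (Module.End F V)) (r : ℤ)
    (h : V →ₗ[F] V →ₛₗ[c] F) (u c₀ : Module.End F V)
    (D : LinearMap.BilinForm 𝓀[F] (W L K K' r)) : Prop :=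
  ∀ X Y : ↥(wNum L K' r), ∃ t : 𝒪[F],
    (t : F) = LinearMap.trace F V (u * ((X : Module.End F V) * c₀ - c₀ * X) * alpha h Y) ∧
    D (W.mk L K K' r X) (W.mk L K K' r Y) = IsLocalRing.residue 𝒪[F] t

end Form

/-- The orthogonal sum `D_0 ⊥ … ⊥ D_d` of bilinear forms. -/
def orthogonalSum {k : Type*} [Field k] {m : ℕ} {M : Fin m → Type*} [∀ j, AddCommGroup (M j)]
    [∀ j, Module k (M j)] (D : ∀ j, LinearMap.BilinForm k (M j)) :
    LinearMap.BilinForm k (⨁ j, M j) :=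
  ∑ j, (D j).compl₁₂ (DirectSum.component k (Fin m) M j) (DirectSum.component k (Fin m) M j)

end StronglyRamified

end

noncomputable section

namespace StronglyRamified

/-! ### Valuations of local fields -/

section LocalField

variable {K : Type*} [Field K] [ValuativeRel K]

/-! Write `u = y⁻¹ϖ_E`, a skew element of `E` of valuation 1. Since `V` is a line over `E`, purity
forces `Λ(k) = 𝔭_E^k w` for a generator `w` (`exists_isGenerator`), so powers of `ϖ_E` shift the
filtration exactly.

If `r_j = 2k` is even, the numerator of `𝔚_{z,j}` already lies in its denominator and the space is
zero. If `r_j = 2k + 1`, then for `X, Y ∈ 𝔓^k` the operator `u[X, c_j]ᵅY` lies in `𝔓^(1 + 2k - r_j)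
= 𝔓^0`, so its trace is integral. Replacing `X` by an element of `𝔓^(k+1)` moves it into `𝔓^1`,
where traces lie in `𝔭_F`; and the commutator vanishes when `X` centralizes `E_j`, because `c_j ∈
E_j`. Taking adjoints gives `c(D(X, Y)) = D(Y, X)`, since `u` and `c_j` are skew and commute; as
`F/F_•` is ramified, `c` is trivial on the residue field, so the reduction is symmetric
(`isSymmIntegral`).

Non-degeneracy (`mem_wDen_of_forall_val_lt_one`) rests on two facts. First, for tame `E/F` the trace
pairing on the centralizer of `E_(j+1)` makes `𝔓^k` and `𝔓^(1-k)` dual modulo `𝔭_F`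
(`IsGenerator.mem_frakP_of_val_trace_lt_one`). An `X` in the radical therefore has `u[X, c_j] ∈
𝔓^(1-k)`, that is `[X, c_j] ∈ 𝔓^(-k)`. Secondly, `X` commutes with `γ_(j+1)`, so `x = ϖ_E^(-k) X`
satisfies `[γ_j, x] ∈ 𝔓^(1-r_j)`, one step above the critical exponent; hence `x` is congruent
modulo `𝔓^1` to an element commuting with `γ_j`. Multiplying back by `ϖ_E^k` puts `X` in the
denominator. The polar form of the quadratic form is `2D`, and 2 is invertible in the residue field.

The estimates on traces all come from `trace_ne_one`: an operator with a power in `𝔪` times an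
integral operator has eigenvalues in a maximal ideal of an integral closure, so they cannot add up
to 1. -/

theorem mem_maximalIdeal_iff (x : 𝒪[K]) : x ∈ 𝓂[K] ↔ valuation K (x : K) < 1 := by
  rw [IsLocalRing.mem_maximalIdeal, mem_nonunits_iff]
  exact Valuation.Integer.not_isUnit_iff_valuation_lt_one

theorem residue_eq_iff (x y : 𝒪[K]) : IsLocalRing.residue 𝒪[K] x = IsLocalRing.residue 𝒪[K] y ↔
    valuation K ((x : K) - y) < 1 := by
  rw [← sub_eq_zero, ← map_sub, IsLocalRing.residue_eq_zero_iff, mem_maximalIdeal_iff]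
  rfl

theorem val_sum_le {ι : Type*} (s : Finset ι) (f : ι → K) {g : ValueGroupWithZero K}
    (hf : ∀ i ∈ s, valuation K (f i) ≤ g) : valuation K (∑ i ∈ s, f i) ≤ g :=
  Valuation.map_sum_le _ hf

theorem val_mul_lt_one {a b : K} (ha : valuation K a ≤ 1) (hb : valuation K b < 1) :
    valuation K (a * b) < 1 := by
  rw [map_mul]
  exact mul_lt_one_of_nonneg_of_lt_one_right ha zero_le hb

theorem val_mul_le_one {a b : K} (ha : valuation K a ≤ 1) (hb : valuation K b ≤ 1) :
    valuation K (a * b) ≤ 1 := by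
  rw [map_mul]
  exact mul_le_one' ha hb

section Uniformizer

variable {ϖ : 𝒪[K]} (hϖ : Irreducible ϖ)
include hϖ

theorem val_irreducible_ne_zero : valuation K (ϖ : K) ≠ 0 :=
  (Valuation.integer.v_irreducible_pos hϖ).ne'

theorem val_irreducible_lt_one : valuation K (ϖ : K) < 1 :=
  Valuation.integer.v_irreducible_lt_one hϖ

theorem irreducible_coe_ne_zero : (ϖ : K) ≠ 0 := by
  intro h
  apply val_irreducible_ne_zero hϖ
  rw [h, map_zero]

theorem val_zpow_le_iff {a b : ℤ} :
    valuation K (ϖ : K) ^ a ≤ valuation K (ϖ : K) ^ b ↔ b ≤ a :=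
  zpow_le_zpow_iff_right_of_lt_one₀ (Valuation.integer.v_irreducible_pos hϖ)
    (val_irreducible_lt_one hϖ)

theorem val_zpow_lt_iff {a b : ℤ} :
    valuation K (ϖ : K) ^ a < valuation K (ϖ : K) ^ b ↔ b < a :=
  zpow_lt_zpow_iff_right_of_lt_one₀ (Valuation.integer.v_irreducible_pos hϖ)
    (val_irreducible_lt_one hϖ)

theorem val_zpow_inj {a b : ℤ} :
    valuation K (ϖ : K) ^ a = valuation K (ϖ : K) ^ b ↔ a = b := by
  rw [le_antisymm_iff, val_zpow_le_iff hϖ, val_zpow_le_iff hϖ]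
  omega

theorem exists_val_eq_zpow [TopologicalSpace K] [IsNonarchimedeanLocalField K] {x : K}
    (hx : x ≠ 0) : ∃ k : ℤ, valuation K x = valuation K (ϖ : K) ^ k := by
  have key : ∀ y : K, y ≠ 0 → valuation K y ≤ 1 →
      ∃ k : ℤ, valuation K y = valuation K (ϖ : K) ^ k := by
    intro y hy hy1
    have hy' : (⟨y, hy1⟩ : 𝒪[K]) ≠ 0 := fun h => hy (congrArg Subtype.val h)
    obtain ⟨n, u, hu⟩ := IsDiscreteValuationRing.eq_unit_mul_pow_irreducible hy' hϖ
    refine ⟨n, ?_⟩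
    have h1 : y = (u : 𝒪[K]) * (ϖ : K) ^ n := by simpa using congrArg Subtype.val hu
    have h2 : valuation K ((u : 𝒪[K]) : K) = 1 :=
      Valuation.Integers.valuation_unit (Valuation.integer.integers (valuation K)) u
    rw [h1, map_mul, h2, one_mul, map_pow, zpow_natCast]
  rcases le_total (valuation K x) 1 with h | h
  · exact key x hx h
  · obtain ⟨k, hk⟩ := key x⁻¹ (inv_ne_zero hx) (by
      rw [map_inv₀]; exact inv_le_one_of_one_le₀ h)
    refine ⟨-k, ?_⟩
    rw [zpow_neg, ← hk, map_inv₀, inv_inv]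

theorem val_lt_zpow_iff [TopologicalSpace K] [IsNonarchimedeanLocalField K] {x : K} {k : ℤ} :
    valuation K x < valuation K (ϖ : K) ^ k ↔ valuation K x ≤ valuation K (ϖ : K) ^ (k + 1) := by
  rcases eq_or_ne x 0 with rfl | hx
  · simp [zero_lt_iff, zpow_ne_zero _ (val_irreducible_ne_zero hϖ)]
  · obtain ⟨m, hm⟩ := exists_val_eq_zpow hϖ hx
    rw [hm, val_zpow_le_iff hϖ, val_zpow_lt_iff hϖ]
    omega

theorem val_lt_one_iff [TopologicalSpace K] [IsNonarchimedeanLocalField K] {x : K} :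
    valuation K x < 1 ↔ valuation K x ≤ valuation K (ϖ : K) := by
  simpa using val_lt_zpow_iff hϖ (x := x) (k := 0)

theorem eq_zero_of_forall_val_le [TopologicalSpace K] [IsNonarchimedeanLocalField K] {x : K}
    (h : ∀ n : ℕ, valuation K x ≤ valuation K (ϖ : K) ^ n) : x = 0 := by
  by_contra hx
  obtain ⟨m, hm⟩ := exists_val_eq_zpow hϖ hx
  have := h (m.toNat + 1)
  rw [hm, ← zpow_natCast, val_zpow_le_iff hϖ] at this
  omega

end Uniformizer

end LocalField

/-! ### Valuations and residue fields in an extension of local fields -/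

section Extension

variable {K L : Type*} [Field K] [ValuativeRel K] [Field L] [ValuativeRel L] [Algebra K L]
  [ValuativeExtension K L]

theorem val_algebraMap_le_iff {x y : K} :
    valuation L (algebraMap K L x) ≤ valuation L (algebraMap K L y) ↔
      valuation K x ≤ valuation K y := by
  rw [← Valuation.vle_iff_le, ← Valuation.vle_iff_le, ValuativeExtension.vle_iff_vle]

theorem val_algebraMap_lt_iff {x y : K} :
    valuation L (algebraMap K L x) < valuation L (algebraMap K L y) ↔
      valuation K x < valuation K y := by
  rw [← not_le, ← not_le, val_algebraMap_le_iff]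

theorem val_algebraMap_le_one_iff {x : K} :
    valuation L (algebraMap K L x) ≤ 1 ↔ valuation K x ≤ 1 := by
  simpa using val_algebraMap_le_iff (K := K) (L := L) (x := x) (y := 1)

theorem val_algebraMap_lt_one_iff {x : K} :
    valuation L (algebraMap K L x) < 1 ↔ valuation K x < 1 := by
  simpa using val_algebraMap_lt_iff (K := K) (L := L) (x := x) (y := 1)

theorem val_algebraMap_eq_one_iff {x : K} :
    valuation L (algebraMap K L x) = 1 ↔ valuation K x = 1 := by
  rw [le_antisymm_iff, le_antisymm_iff, ← not_lt (b := (1 : ValueGroupWithZero L)),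
    ← not_lt (b := (1 : ValueGroupWithZero K)), val_algebraMap_le_one_iff, val_algebraMap_lt_one_iff]

variable (K L) in
/-- A valuation-theoretic description of a basis of the residue field extension, together with an
element whose residue has non-zero trace. -/
theorem exists_residue_basis [TopologicalSpace K] [IsNonarchimedeanLocalField K]
    [TopologicalSpace L] [IsNonarchimedeanLocalField L] :
    ∃ (f : ℕ) (b : Fin f → L), (∀ j, valuation L (b j) ≤ 1) ∧
      (∀ x, valuation L x ≤ 1 → ∃ a : Fin f → K, (∀ j, valuation K (a j) ≤ 1) ∧
        valuation L (x - ∑ j, algebraMap K L (a j) * b j) < 1) ∧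
      (∀ a : Fin f → K, (∀ j, valuation K (a j) ≤ 1) →
        valuation L (∑ j, algebraMap K L (a j) * b j) < 1 → ∀ j, valuation K (a j) < 1) ∧
      ∃ (x : L) (A : Fin f → Fin f → K), valuation L x ≤ 1 ∧ (∀ l j, valuation K (A l j) ≤ 1) ∧
        (∀ j, valuation L (x * b j - ∑ l, algebraMap K L (A l j) * b l) < 1) ∧
        valuation K (∑ j, A j j) = 1 := by
  have hext : (valuation K).HasExtension (valuation L) := ⟨fun x y => val_algebraMap_le_iff.symm⟩
  let B := Module.finBasis 𝓀[K] 𝓀[L]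
  have hr : Function.Surjective (IsLocalRing.residue 𝒪[K]) := IsLocalRing.residue_surjective
  have hr' : Function.Surjective (IsLocalRing.residue 𝒪[L]) := IsLocalRing.residue_surjective
  choose b hb using fun j => hr' (B j)
  have hsum : ∀ a : Fin (Module.finrank 𝓀[K] 𝓀[L]) → 𝒪[K],
      IsLocalRing.residue 𝒪[L] (∑ j, algebraMap 𝒪[K] 𝒪[L] (a j) * b j) =
        ∑ j, IsLocalRing.residue 𝒪[K] (a j) • B j := by
    intro a
    rw [map_sum]
    refine Finset.sum_congr rfl fun j _ => ?_
    rw [map_mul, hb, Algebra.smul_def]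
    rfl
  have hcoe : ∀ a : Fin (Module.finrank 𝓀[K] 𝓀[L]) → 𝒪[K],
      ((∑ j, algebraMap 𝒪[K] 𝒪[L] (a j) * b j : 𝒪[L]) : L) =
        ∑ j, algebraMap K L (a j) * b j := by
    intro a
    simp
  have hspan : ∀ x : 𝒪[L], ∃ a : Fin (Module.finrank 𝓀[K] 𝓀[L]) → 𝒪[K],
      (∀ j, IsLocalRing.residue 𝒪[K] (a j) = B.repr (IsLocalRing.residue 𝒪[L] x) j) ∧
      valuation L (x - ∑ j, algebraMap K L (a j) * b j) < 1 := by
    intro x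
    choose a ha using fun j => hr (B.repr (IsLocalRing.residue 𝒪[L] x) j)
    refine ⟨a, ha, ?_⟩
    rw [← hcoe, ← residue_eq_iff, hsum]
    simp [ha, B.sum_repr]
  refine ⟨_, fun j => b j, fun j => (b j).2, fun x hx => ?_, fun a ha h j => ?_, ?_⟩
  · obtain ⟨a, -, ha⟩ := hspan ⟨x, hx⟩
    exact ⟨fun j => a j, fun j => (a j).2, ha⟩
  · let a' : Fin (Module.finrank 𝓀[K] 𝓀[L]) → 𝒪[K] := fun j => ⟨a j, ha j⟩
    have h1 : IsLocalRing.residue 𝒪[L] (∑ j, algebraMap 𝒪[K] 𝒪[L] (a' j) * b j) = 0 := by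
      rw [IsLocalRing.residue_eq_zero_iff, mem_maximalIdeal_iff, hcoe]
      exact h
    rw [hsum] at h1
    have h2 := Fintype.linearIndependent_iff.mp B.linearIndependent _ h1 j
    rw [IsLocalRing.residue_eq_zero_iff, mem_maximalIdeal_iff] at h2
    exact h2
  -- Finite fields are perfect, so the residue extension is separable and its trace is onto.
  · obtain ⟨t, ht⟩ := Algebra.trace_surjective 𝓀[K] 𝓀[L] 1
    obtain ⟨x, rfl⟩ := hr' t
    choose A hA hA' using fun j => hspan (x * b j)
    refine ⟨x, fun l j => A j l, x.2, fun l j => (A j l).2, fun j => hA' j, ?_⟩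
    have h1 : IsLocalRing.residue 𝒪[K] (∑ j, A j j) = 1 := by
      rw [map_sum, ← ht, Algebra.trace_eq_matrix_trace B, Matrix.trace]
      refine Finset.sum_congr rfl fun j _ => ?_
      rw [hA, Matrix.diag_apply, Algebra.leftMulMatrix_eq_repr_mul, map_mul, hb]
    have h2 : IsUnit (∑ j, A j j) := by
      rw [← IsLocalRing.residue_ne_zero_iff_isUnit, h1]
      exact one_ne_zero
    have h3 : valuation K ((∑ j, A j j : 𝒪[K]) : K) = 1 :=
      Valuation.Integers.one_of_isUnit (Valuation.integer.integers (valuation K)) h2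
    simpa using h3

end Extension

/-! ### The basis `ϖ^i b_j` built from a uniformizer and a residue basis -/

section RamifiedBasis

theorem isPrecomplete_integer (K : Type*) [Field K] [ValuativeRel K] [TopologicalSpace K]
    [IsNonarchimedeanLocalField K] : IsPrecomplete 𝓂[K] 𝒪[K] := by
  let := IsTopologicalAddGroup.rightUniformSpace K
  have := isUniformAddGroup_of_addCommGroup (G := K)
  have h : IsAdicComplete 𝓂[K] 𝒪[K] := inferInstance
  exact h.toIsPrecomplete

theorem val_le_of_mem_maximalIdeal_pow {K : Type*} [Field K] [ValuativeRel K] [TopologicalSpace K]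
    [IsNonarchimedeanLocalField K] {π : 𝒪[K]} (hπ : Irreducible π) {n : ℕ} {x : 𝒪[K]}
    (hx : x ∈ 𝓂[K] ^ n) : valuation K (x : K) ≤ valuation K (π : K) ^ n := by
  rw [hπ.maximalIdeal_eq, Ideal.span_singleton_pow, Ideal.mem_span_singleton] at hx
  obtain ⟨y, rfl⟩ := hx
  have h1 : ((π ^ n * y : 𝒪[K]) : K) = (π : K) ^ n * y := by simp
  rw [h1, map_mul, map_pow]
  exact mul_le_of_le_one_right' y.2

variable {K L : Type*} [Field K] [ValuativeRel K] [TopologicalSpace K]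
  [IsNonarchimedeanLocalField K] [Field L] [ValuativeRel L] [TopologicalSpace L]
  [IsNonarchimedeanLocalField L] [Algebra K L] [ValuativeExtension K L]

/-- A finite family that spans the integers of `L` modulo a uniformizer of `K` spans them. -/
theorem exists_sum_eq_of_span_mod {ι : Type*} [Fintype ι] {π : 𝒪[K]} (hπ : Irreducible π)
    (B : ι → L) (hB : ∀ i, valuation L (B i) ≤ 1)
    (hstep : ∀ x, valuation L x ≤ 1 → ∃ a : ι → 𝒪[K], ∃ x', valuation L x' ≤ 1 ∧
      x = ∑ i, algebraMap K L (a i) * B i + algebraMap K L π * x')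
    {x : L} (hx : valuation L x ≤ 1) :
    ∃ a : ι → 𝒪[K], x = ∑ i, algebraMap K L (a i) * B i := by
  choose A N hN hAN using fun x : 𝒪[L] => hstep x x.2
  let N' : 𝒪[L] → 𝒪[L] := fun x => ⟨N x, hN x⟩
  let X : ℕ → 𝒪[L] := fun n => N'^[n] ⟨x, hx⟩
  let s : ι → ℕ → 𝒪[K] := fun i n => ∑ m ∈ Finset.range n, π ^ m * A (X m) i
  have hs : ∀ n, x = ∑ i, algebraMap K L (s i n) * B i + algebraMap K L π ^ n * X n := by
    intro n
    induction n with
    | zero => simp [s, X]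
    | succ n ih =>
      have h1 : (X (n + 1) : L) = N (X n) := by
        simp only [X, Function.iterate_succ_apply', N']
      have h2 := hAN (X n)
      have h3 : ∀ i, algebraMap K L (s i (n + 1)) * B i =
          algebraMap K L (s i n) * B i + algebraMap K L π ^ n * (algebraMap K L (A (X n) i) * B i) := by
        intro i
        have h4 : (s i (n + 1) : K) = s i n + (π : K) ^ n * A (X n) i := by
          rw [show s i (n + 1) = s i n + π ^ n * A (X n) i from Finset.sum_range_succ _ _]
          simp
        rw [h4, map_add, map_mul, map_pow]
        ring
      rw [Finset.sum_congr rfl fun i _ => h3 i, Finset.sum_add_distrib, ← Finset.mul_sum, h1,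
        pow_succ, add_assoc, mul_assoc, ← mul_add, ← h2]
      exact ih
  have := isPrecomplete_integer K
  have hlim : ∀ i, ∃ r : 𝒪[K], ∀ n, s i n ≡ r [SMOD (𝓂[K] ^ n • ⊤ : Submodule 𝒪[K] 𝒪[K])] := by
    intro i
    refine IsPrecomplete.prec' (s i) fun {m n} hmn => ?_
    rw [SModEq.sub_mem, smul_eq_mul, Ideal.mul_top, ← neg_mem_iff, neg_sub]
    simp only [s]
    rw [← Finset.sum_range_add_sum_Ico _ hmn, add_sub_cancel_left]
    refine Ideal.sum_mem _ fun k hk => Ideal.mul_mem_right _ _ ?_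
    refine Ideal.pow_le_pow_right (Finset.mem_Ico.mp hk).1 (Ideal.pow_mem_pow ?_ k)
    rw [mem_maximalIdeal_iff]
    exact val_irreducible_lt_one hπ
  choose r hr using hlim
  refine ⟨r, sub_eq_zero.mp ?_⟩
  obtain ⟨ϖ, hϖ⟩ := IsDiscreteValuationRing.exists_irreducible 𝒪[L]
  have hπL : valuation L (algebraMap K L π) ≤ valuation L (ϖ : L) :=
    (val_lt_one_iff hϖ).mp (val_algebraMap_lt_one_iff.mpr (val_irreducible_lt_one hπ))
  refine eq_zero_of_forall_val_le hϖ fun n => ?_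
  refine le_trans ?_ (pow_le_pow_left' hπL n)
  have h4 : x - ∑ i, algebraMap K L (r i) * B i =
      ∑ i, algebraMap K L (s i n - r i) * B i + algebraMap K L π ^ n * X n := by
    conv_lhs => rw [hs n]
    simp only [map_sub, sub_mul, Finset.sum_sub_distrib]
    ring
  rw [h4]
  refine (Valuation.map_add_le _ (val_sum_le _ _ fun i _ => ?_) ?_)
  · rw [map_mul]
    refine (mul_le_of_le_one_right' (hB i)).trans ?_
    rw [← map_pow, ← map_pow, val_algebraMap_le_iff, map_pow]
    have := hr i n
    rw [SModEq.sub_mem, smul_eq_mul, Ideal.mul_top] at this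
    exact val_le_of_mem_maximalIdeal_pow hπ this
  · rw [map_mul, map_pow]
    exact mul_le_of_le_one_right' (X n).2

section

variable {π : 𝒪[K]} (hπ : Irreducible π) {ϖ : 𝒪[L]} (hϖ : Irreducible ϖ) {e : ℕ}
  (he : valuation L (algebraMap K L π) = valuation L (ϖ : L) ^ e) {f : ℕ} {b : Fin f → L}
  (hb : ∀ j, valuation L (b j) ≤ 1)

omit [TopologicalSpace K] [IsNonarchimedeanLocalField K] [ValuativeExtension K L] in
include hϖ in
-- Digits are extracted one power of `ϖ` at a time; for `m = e` the error becomes divisible by a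
-- uniformizer of `K`.
theorem exists_sub_sum_le
    (hspan : ∀ x, valuation L x ≤ 1 → ∃ a : Fin f → K, (∀ j, valuation K (a j) ≤ 1) ∧
      valuation L (x - ∑ j, algebraMap K L (a j) * b j) < 1)
    {x : L} (hx : valuation L x ≤ 1) (m : ℕ) : ∃ a : ℕ → Fin f → 𝒪[K],
      valuation L (x - ∑ i ∈ Finset.range m, ∑ j, algebraMap K L (a i j) * ((ϖ : L) ^ i * b j)) ≤
        valuation L (ϖ : L) ^ m := by
  have hϖ0 := irreducible_coe_ne_zero hϖ
  induction m with
  | zero => exact ⟨0, by simpa using hx⟩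
  | succ m ih =>
    obtain ⟨a, ha⟩ := ih
    set y := x - ∑ i ∈ Finset.range m, ∑ j, algebraMap K L (a i j) * ((ϖ : L) ^ i * b j) with hy
    have hy1 : valuation L (y / (ϖ : L) ^ m) ≤ 1 := by
      rw [map_div₀, map_pow]
      exact div_le_one_of_le₀ ha zero_le
    obtain ⟨a', ha', h⟩ := hspan _ hy1
    let a₁ : Fin f → 𝒪[K] := fun j => ⟨a' j, ha' j⟩
    refine ⟨Function.update a m a₁, ?_⟩
    have h1 : x - ∑ i ∈ Finset.range (m + 1), ∑ j, algebraMap K L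
          (Function.update a m a₁ i j) * ((ϖ : L) ^ i * b j) =
        (ϖ : L) ^ m * (y / (ϖ : L) ^ m - ∑ j, algebraMap K L (a' j) * b j) := by
      rw [Finset.sum_range_succ, mul_sub, mul_div_cancel₀ _ (pow_ne_zero _ hϖ0), hy, sub_sub,
        Finset.mul_sum]
      congr 2
      · refine Finset.sum_congr rfl fun i hi => ?_
        rw [Function.update_of_ne (Finset.mem_range.mp hi).ne]
      · refine Finset.sum_congr rfl fun j _ => ?_
        rw [Function.update_self]
        ring
    rw [h1, map_mul, map_pow, pow_succ]
    gcongr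
    exact (val_lt_one_iff hϖ).mp h

include hϖ hb he hπ in
theorem exists_eq_sum_ramified
    (hspan : ∀ x, valuation L x ≤ 1 → ∃ a : Fin f → K, (∀ j, valuation K (a j) ≤ 1) ∧
      valuation L (x - ∑ j, algebraMap K L (a j) * b j) < 1)
    {x : L} (hx : valuation L x ≤ 1) : ∃ a : Fin e × Fin f → 𝒪[K],
      x = ∑ p, algebraMap K L (a p) * ((ϖ : L) ^ (p.1 : ℕ) * b p.2) := by
  refine exists_sum_eq_of_span_mod hπ (fun p : Fin e × Fin f => (ϖ : L) ^ (p.1 : ℕ) * b p.2)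
    (fun p => ?_) (fun x hx => ?_) hx
  · refine val_mul_le_one ?_ (hb _)
    rw [map_pow]
    exact pow_le_one' (val_irreducible_lt_one hϖ).le _
  · obtain ⟨a, ha⟩ := exists_sub_sum_le hϖ hspan hx e
    have hπ0 : algebraMap K L π ≠ 0 := by
      simpa using irreducible_coe_ne_zero hπ
    refine ⟨fun p => a p.1 p.2, (x - ∑ i ∈ Finset.range e, ∑ j,
      algebraMap K L (a i j) * ((ϖ : L) ^ i * b j)) / algebraMap K L π, ?_, ?_⟩
    · rw [map_div₀, he]
      exact div_le_one_of_le₀ ha zero_le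
    · rw [mul_div_cancel₀ _ hπ0, Fintype.sum_prod_type, ← Fin.sum_univ_eq_sum_range
        (fun i => ∑ j, algebraMap K L (a i j) * ((ϖ : L) ^ i * b j))]
      ring

include hϖ hb he hπ in
-- Induction on the exponent `i` of `ϖ`. Coefficients of lower blocks are already in `𝔭_K`, so these
-- blocks are divisible by `ϖ^e`, and higher blocks are divisible by `ϖ^(i+1)`. The `i`-th block,
-- divided by `ϖ^i`, is then a vanishing combination in the residue field.
theorem coeff_lt_one_of_sum_le
    (hindep : ∀ a : Fin f → K, (∀ j, valuation K (a j) ≤ 1) →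
      valuation L (∑ j, algebraMap K L (a j) * b j) < 1 → ∀ j, valuation K (a j) < 1)
    (a : Fin e × Fin f → K) (ha : ∀ p, valuation K (a p) ≤ 1) {m : ℕ}
    (hm : valuation L (∑ p, algebraMap K L (a p) * ((ϖ : L) ^ (p.1 : ℕ) * b p.2)) ≤
      valuation L (ϖ : L) ^ m) (p : Fin e × Fin f) (hp : (p.1 : ℕ) < m) :
    valuation K (a p) < 1 := by
  obtain ⟨i, j⟩ := p
  obtain ⟨i, hi⟩ := i
  induction i using Nat.strong_induction_on generalizing j with
  | _ i ih =>
  simp only at hp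
  have hq := val_irreducible_lt_one hϖ
  have hϖ0 := irreducible_coe_ne_zero hϖ
  let S : Fin e → L := fun i => ∑ j, algebraMap K L (a (i, j)) * ((ϖ : L) ^ (i : ℕ) * b j)
  have hother : ∀ i' : Fin e, i' ≠ ⟨i, hi⟩ → valuation L (S i') ≤ valuation L (ϖ : L) ^ (i + 1) := by
    intro i' hi'
    refine val_sum_le _ _ fun j' _ => ?_
    rcases lt_or_gt_of_ne (fun h => hi' (Fin.ext h) : (i' : ℕ) ≠ i) with h | h
    · have h1 := ih i' h j' i'.2 (by simp only; omega)
      have h2 : valuation L (algebraMap K L (a (i', j'))) ≤ valuation L (ϖ : L) ^ e := by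
        rw [← he, val_algebraMap_le_iff]
        exact (val_lt_one_iff hπ).mp h1
      rw [map_mul]
      refine (mul_le_of_le_one_right' (val_mul_le_one ?_ (hb _))).trans (h2.trans ?_)
      · rw [map_pow]
        exact pow_le_one' hq.le _
      · exact pow_le_pow_right_of_le_one' hq.le hi
    · rw [← mul_assoc, mul_comm (algebraMap K L _), mul_assoc, map_mul, map_pow]
      refine (mul_le_of_le_one_right' (val_mul_le_one ?_ (hb _))).trans ?_
      · rw [val_algebraMap_le_one_iff]
        exact ha _
      · exact pow_le_pow_right_of_le_one' hq.le h
  have h1 : valuation L (S ⟨i, hi⟩) ≤ valuation L (ϖ : L) ^ (i + 1) := by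
    have h2 : S ⟨i, hi⟩ = ∑ p, algebraMap K L (a p) * ((ϖ : L) ^ (p.1 : ℕ) * b p.2) -
        ∑ i' ∈ Finset.univ.erase ⟨i, hi⟩, S i' := by
      rw [Fintype.sum_prod_type, eq_sub_iff_add_eq]
      exact Finset.add_sum_erase _ S (Finset.mem_univ _)
    rw [h2]
    refine Valuation.map_sub_le _ (hm.trans (pow_le_pow_right_of_le_one' hq.le hp)) ?_
    exact val_sum_le _ _ fun i' hi' => hother i' (Finset.ne_of_mem_erase hi')
  have h3 : S ⟨i, hi⟩ = (ϖ : L) ^ i * ∑ j, algebraMap K L (a (⟨i, hi⟩, j)) * b j := by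
    rw [Finset.mul_sum]
    refine Finset.sum_congr rfl fun j _ => ?_
    simp only
    ring
  refine hindep (fun j => a (⟨i, hi⟩, j)) (fun j => ha _) ?_ j
  rw [h3, map_mul, map_pow, pow_succ] at h1
  rw [val_lt_one_iff hϖ]
  exact le_of_mul_le_mul_left h1 (pow_pos (Valuation.integer.v_irreducible_pos hϖ) i)

include hϖ hb he hπ in
-- A relation scaled so that its largest coefficient is 1 contradicts `coeff_lt_one_of_sum_le`.
theorem linearIndependent_ramified
    (hindep : ∀ a : Fin f → K, (∀ j, valuation K (a j) ≤ 1) →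
      valuation L (∑ j, algebraMap K L (a j) * b j) < 1 → ∀ j, valuation K (a j) < 1) :
    LinearIndependent K fun p : Fin e × Fin f => (ϖ : L) ^ (p.1 : ℕ) * b p.2 := by
  rw [Fintype.linearIndependent_iff]
  intro a ha p
  by_contra hp
  obtain ⟨p₀, -, hmax⟩ := Finset.exists_max_image Finset.univ (fun p => valuation K (a p))
    ⟨p, Finset.mem_univ p⟩
  have h0 : a p₀ ≠ 0 := by
    intro h
    have := hmax p (Finset.mem_univ p)
    rw [h, map_zero, le_zero_iff, map_eq_zero] at this
    exact hp this
  have h1 := coeff_lt_one_of_sum_le hπ hϖ he hb hindep (fun p => a p / a p₀)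
    (fun p => by
      rw [map_div₀]
      exact div_le_one_of_le₀ (hmax p (Finset.mem_univ p)) zero_le) (m := e) (by
      have h2 : ∑ p : Fin e × Fin f, algebraMap K L (a p / a p₀) * ((ϖ : L) ^ (p.1 : ℕ) * b p.2) =
          0 := by
        have h3 : ∀ p : Fin e × Fin f, algebraMap K L (a p / a p₀) * ((ϖ : L) ^ (p.1 : ℕ) * b p.2) =
            algebraMap K L (a p₀)⁻¹ * (a p • ((ϖ : L) ^ (p.1 : ℕ) * b p.2)) := by
          intro p
          rw [Algebra.smul_def, div_eq_mul_inv, map_mul]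
          ring
        rw [Finset.sum_congr rfl fun p _ => h3 p, ← Finset.mul_sum, ha, mul_zero]
      rw [h2, map_zero]
      exact zero_le) p₀ p₀.1.2
  rw [div_self h0, map_one] at h1
  exact lt_irrefl _ h1

end

end RamifiedBasis

/-! ### Integrality, the ramification index, and traces in tame extensions -/

section Consequences

variable (K L : Type*) [Field K] [ValuativeRel K] [TopologicalSpace K]
  [IsNonarchimedeanLocalField K] [Field L] [ValuativeRel L] [TopologicalSpace L]
  [IsNonarchimedeanLocalField L] [Algebra K L] [ValuativeExtension K L]

omit [TopologicalSpace K] [IsNonarchimedeanLocalField K] in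
variable {K L} in
theorem exists_val_eq_pow {π : 𝒪[K]} (hπ : Irreducible π) {ϖ : 𝒪[L]} (hϖ : Irreducible ϖ) :
    ∃ e : ℕ, 0 < e ∧ valuation L (algebraMap K L π) = valuation L (ϖ : L) ^ e := by
  obtain ⟨k, hk⟩ := exists_val_eq_zpow hϖ (x := algebraMap K L π)
    (by simpa using irreducible_coe_ne_zero hπ)
  have h1 : valuation L (algebraMap K L π) < 1 :=
    val_algebraMap_lt_one_iff.mpr (val_irreducible_lt_one hπ)
  have h2 : 0 < k := by
    rw [hk, ← zpow_zero (valuation L (ϖ : L)), val_zpow_lt_iff hϖ] at h1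
    exact h1
  refine ⟨k.toNat, by omega, ?_⟩
  rw [hk, ← zpow_natCast, Int.toNat_of_nonneg h2.le]

variable {L} in
-- The integers of `L` form a subalgebra that is finitely generated over `𝒪[K]` by the elements `ϖ^i
-- b_j`.
theorem isIntegral_of_val_le_one {x : L} (hx : valuation L x ≤ 1) : IsIntegral 𝒪[K] x := by
  classical
  obtain ⟨π, hπ⟩ := IsDiscreteValuationRing.exists_irreducible 𝒪[K]
  obtain ⟨ϖ, hϖ⟩ := IsDiscreteValuationRing.exists_irreducible 𝒪[L]
  obtain ⟨e, -, he⟩ := exists_val_eq_pow hπ hϖ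
  obtain ⟨f, b, hb, hspan, -, -⟩ := exists_residue_basis K L
  let O : Subalgebra 𝒪[K] L :=
    { (valuation L).integer with
      algebraMap_mem' := fun r => val_algebraMap_le_one_iff.mpr r.2 }
  refine IsIntegral.of_mem_of_fg O ?_ x hx
  refine ⟨Finset.univ.image fun p : Fin e × Fin f => (ϖ : L) ^ (p.1 : ℕ) * b p.2,
    le_antisymm (Submodule.span_le.mpr ?_) ?_⟩
  · intro y hy
    obtain ⟨p, -, rfl⟩ := Finset.mem_image.mp hy
    refine val_mul_le_one ?_ (hb _)
    rw [map_pow]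
    exact pow_le_one' (val_irreducible_lt_one hϖ).le _
  · intro y hy
    obtain ⟨a, ha⟩ := exists_eq_sum_ramified hπ hϖ he hb hspan hy
    rw [ha]
    refine Submodule.sum_mem _ fun p _ => ?_
    rw [← Algebra.smul_def]
    exact Submodule.smul_mem _ (a p) (Submodule.subset_span
      (Finset.mem_image_of_mem _ (Finset.mem_univ p)))

variable {K L} in
-- The value group of `L` is the image of `ℤ` under powers of `ϖ`, and the values of `Kˣ` pull back
-- to `eℤ`.
theorem ramIdx_eq {π : 𝒪[K]} (hπ : Irreducible π) {ϖ : 𝒪[L]} (hϖ : Irreducible ϖ) {e : ℕ}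
    (he : valuation L (algebraMap K L π) = valuation L (ϖ : L) ^ e) : ramIdx K L = e := by
  have hπ0 := irreducible_coe_ne_zero hπ
  let u : (ValueGroupWithZero L)ˣ := Units.mk0 _ (val_irreducible_ne_zero hϖ)
  let ψ : Multiplicative ℤ →* (ValueGroupWithZero L)ˣ := zpowersHom _ u
  have hψ : Function.Surjective ψ := by
    intro g
    obtain ⟨x, hx⟩ := valuation_surjective (g : ValueGroupWithZero L)
    have hx0 : x ≠ 0 := by
      rintro rfl
      exact g.ne_zero (by rw [← hx, map_zero])
    obtain ⟨k, hk⟩ := exists_val_eq_zpow hϖ hx0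
    exact ⟨Multiplicative.ofAdd k, Units.ext (by simp [ψ, u, ← hk, hx])⟩
  unfold ramIdx
  rw [← Subgroup.index_comap_of_surjective _ hψ]
  have h1 : ∀ m : ℤ, valuation L (algebraMap K L ((π : K) ^ m)) =
      valuation L (ϖ : L) ^ ((e : ℤ) * m) := by
    intro m
    rw [map_zpow₀, map_zpow₀, he, ← zpow_natCast, ← zpow_mul]
  have h2 : (Subgroup.comap ψ (Units.map ((valuation L).toMonoidWithZeroHom.toMonoidHom.comp
      (algebraMap K L).toMonoidHom)).range) = (AddSubgroup.zmultiples (e : ℤ)).toSubgroup := by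
    ext n
    have h3 : n ∈ (AddSubgroup.zmultiples (e : ℤ)).toSubgroup ↔ (e : ℤ) ∣ n.toAdd :=
      Int.mem_zmultiples_iff
    rw [h3, Subgroup.mem_comap, MonoidHom.mem_range]
    constructor
    · rintro ⟨a, ha⟩
      have ha' : valuation L (algebraMap K L a) = valuation L (ϖ : L) ^ n.toAdd := by
        have := congrArg Units.val ha
        simpa [ψ, u] using this
      obtain ⟨m, hm⟩ := exists_val_eq_zpow hπ a.ne_zero
      rw [← map_zpow₀] at hm
      have h4 : valuation L (algebraMap K L a) = valuation L (algebraMap K L ((π : K) ^ m)) :=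
        le_antisymm (val_algebraMap_le_iff.mpr hm.le) (val_algebraMap_le_iff.mpr hm.ge)
      rw [ha', h1, val_zpow_inj hϖ] at h4
      exact ⟨m, h4⟩
    · rintro ⟨m, hm⟩
      refine ⟨Units.mk0 ((π : K) ^ m) (zpow_ne_zero _ hπ0), Units.ext ?_⟩
      have h5 := h1 m
      rw [← hm] at h5
      simpa [ψ, u] using h5
  rw [h2, AddSubgroup.index_toSubgroup, Int.index_zmultiples, Int.natAbs_natCast]

theorem val_natCast_eq_one {p : ℕ} (hp : ¬ ringChar 𝓀[K] ∣ p) : valuation K (p : K) = 1 := by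
  have h1 : IsLocalRing.residue 𝒪[K] (p : 𝒪[K]) ≠ 0 := by
    rw [map_natCast]
    exact fun h => hp (ringChar.dvd h)
  rw [IsLocalRing.residue_ne_zero_iff_isUnit] at h1
  have := Valuation.Integers.one_of_isUnit (Valuation.integer.integers (valuation K)) h1
  simpa using this

/-- In a tamely ramified extension the trace of some integer is a unit. -/
theorem exists_val_trace_eq_one [FiniteDimensional K L] (htame : ¬ ringChar 𝓀[K] ∣ ramIdx K L) :
    ∃ x : L, valuation L x ≤ 1 ∧ valuation K (Algebra.trace K L x) = 1 := by
  obtain ⟨π, hπ⟩ := IsDiscreteValuationRing.exists_irreducible 𝒪[K]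
  obtain ⟨ϖ, hϖ⟩ := IsDiscreteValuationRing.exists_irreducible 𝒪[L]
  have hϖ0 := irreducible_coe_ne_zero hϖ
  obtain ⟨e, -, he⟩ := exists_val_eq_pow hπ hϖ
  rw [ramIdx_eq hπ hϖ he] at htame
  obtain ⟨f, b, hb, hspan, hindep, x, A, hx, hA, hxA, htr⟩ := exists_residue_basis K L
  have hli := linearIndependent_ramified hπ hϖ he hb hindep
  have hsp : ⊤ ≤ Submodule.span K (Set.range fun p : Fin e × Fin f =>
      (ϖ : L) ^ (p.1 : ℕ) * b p.2) := by
    intro y _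
    -- A power of `π` clears the denominators of `y`.
    obtain ⟨n, hn⟩ : ∃ n : ℕ, valuation L (algebraMap K L ((π : K) ^ n) * y) ≤ 1 := by
      by_cases hy : y = 0
      · exact ⟨0, by simp [hy]⟩
      · by_contra! hlt
        refine hy (inv_eq_zero.mp (eq_zero_of_forall_val_le hϖ (x := y⁻¹) fun n => ?_))
        have h2 := hlt n
        rw [map_mul] at h2
        have h3 : valuation L (algebraMap K L ((π : K) ^ n)) ≤ valuation L (ϖ : L) ^ n := by
          rw [map_pow, map_pow]
          exact pow_le_pow_left' ((val_lt_one_iff hϖ).mp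
            (val_algebraMap_lt_one_iff.mpr (val_irreducible_lt_one hπ))) n
        rw [map_inv₀]
        rw [inv_le_iff_one_le_mul₀ (by simpa [zero_lt_iff] using hy)]
        exact h2.le.trans (by gcongr)
    obtain ⟨a, ha⟩ := exists_eq_sum_ramified hπ hϖ he hb hspan hn
    have h1 : y = algebraMap K L ((π : K) ^ n)⁻¹ * (algebraMap K L ((π : K) ^ n) * y) := by
      rw [← mul_assoc, ← map_mul, inv_mul_cancel₀ (pow_ne_zero _ (irreducible_coe_ne_zero hπ)),
        map_one, one_mul]
    rw [h1, ha, ← Algebra.smul_def]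
    refine Submodule.smul_mem _ _ (Submodule.sum_mem _ fun p _ => ?_)
    rw [← Algebra.smul_def]
    exact Submodule.smul_mem _ _ (Submodule.subset_span ⟨p, rfl⟩)
  let B := Module.Basis.mk hli hsp
  have hBp : ∀ p, B p = (ϖ : L) ^ (p.1 : ℕ) * b p.2 := fun p => by simp [B]
  have hrepr : ∀ y : L, y = ∑ p, algebraMap K L (B.repr y p) * ((ϖ : L) ^ (p.1 : ℕ) * b p.2) := by
    intro y
    conv_lhs => rw [← B.sum_repr y]
    exact Finset.sum_congr rfl fun p _ => by rw [hBp, Algebra.smul_def]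
  have hint : ∀ y : L, valuation L y ≤ 1 → ∀ p, valuation K (B.repr y p) ≤ 1 := by
    intro y hy p
    obtain ⟨a, ha⟩ := exists_eq_sum_ramified hπ hϖ he hb hspan hy
    have h1 : y = ∑ p, (a p : K) • B p := by
      rw [ha]
      exact Finset.sum_congr rfl fun p _ => by rw [hBp, Algebra.smul_def]
    rw [h1, B.repr_sum_self]
    exact (a p).2
  have hsmall : ∀ (p : Fin e × Fin f) (y : L), valuation L y ≤ valuation L (ϖ : L) ^ ((p.1 : ℕ) + 1) →
      valuation K (B.repr y p) < 1 := by
    intro p y hy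
    have h1 : valuation L y ≤ 1 := hy.trans (pow_le_one' (val_irreducible_lt_one hϖ).le _)
    refine coeff_lt_one_of_sum_le hπ hϖ he hb hindep (fun p => B.repr y p) (hint y h1)
      (m := (p.1 : ℕ) + 1) ?_ p (Nat.lt_succ_self _)
    rw [← hrepr]
    exact hy
  -- Modulo `𝔭_K`, each of the `e` diagonal blocks of multiplication by `x` is the matrix `A` of its
  -- residue; the trace is thus `e · tr A` modulo `𝔭_K`, and `e` is a unit by tameness.
  have hdiag : ∀ p : Fin e × Fin f, valuation K (B.repr (x * B p) p - A p.2 p.2) < 1 := by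
    rintro ⟨i, j⟩
    have h1 : x * B (i, j) = ∑ l, A l j • B (i, l) +
        (ϖ : L) ^ (i : ℕ) * (x * b j - ∑ l, algebraMap K L (A l j) * b l) := by
      rw [hBp, mul_sub, Finset.mul_sum]
      have h2 : ∀ l, A l j • B (i, l) = (ϖ : L) ^ (i : ℕ) * (algebraMap K L (A l j) * b l) := by
        intro l
        rw [hBp, Algebra.smul_def]
        ring
      rw [Finset.sum_congr rfl fun l _ => h2 l]
      ring
    have h3 : B.repr (∑ l, A l j • B (i, l)) (i, j) = A j j := by
      simp [Finsupp.single_apply]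
    rw [h1, map_add, Finsupp.add_apply, h3, add_sub_cancel_left]
    refine hsmall (i, j) _ ?_
    rw [map_mul, map_pow, pow_succ]
    gcongr
    exact (val_lt_one_iff hϖ).mp (hxA j)
  refine ⟨x, hx, ?_⟩
  have h1 : Algebra.trace K L x = (e : K) * ∑ j, A j j +
      ∑ p, (B.repr (x * B p) p - A p.2 p.2) := by
    rw [Algebra.trace_eq_matrix_trace B, Matrix.trace, Finset.sum_sub_distrib,
      Fintype.sum_prod_type (f := fun p : Fin e × Fin f => A p.2 p.2)]
    simp [Algebra.leftMulMatrix_eq_repr_mul]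
  have h2 : valuation K (∑ p, (B.repr (x * B p) p - A p.2 p.2)) < 1 :=
    Valuation.map_sum_lt _ one_ne_zero fun p _ => hdiag p
  have h3 : valuation K ((e : K) * ∑ j, A j j) = 1 := by
    rw [map_mul, htr, val_natCast_eq_one K htame, mul_one]
  rw [h1, Valuation.map_add_eq_of_lt_left _ (by rw [h3]; exact h2), h3]

end Consequences

/-! ### Traces of topologically nilpotent operators -/

section TraceNeOne

open Polynomial

/-- An endomorphism with a power in `𝔪 Z`, where `Z` is integral, does not have trace `1`. -/
theorem trace_ne_one {R K M : Type*} [CommRing R] [IsLocalRing R] [Field K] (φ : R →+* K)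
    (hφ : Function.Injective φ) [AddCommGroup M] [Module K M] [FiniteDimensional K M]
    (X Z : Module.End K M) {N : ℕ} (hN : N ≠ 0) {a : R} (ha : a ∈ IsLocalRing.maximalIdeal R)
    (hX : X ^ N = φ a • Z) {P : R[X]} (hP : P.Monic) (hZ : aeval Z (P.map φ) = 0) :
    LinearMap.trace K M X ≠ 1 := by
  classical
  intro htr
  let Ω := AlgebraicClosure K
  let ψ : R →+* Ω := (algebraMap K Ω).comp φ
  let : Algebra R Ω := ψ.toAlgebra
  have hψ : Function.Injective (algebraMap R Ω) := (algebraMap K Ω).injective.comp hφ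
  let I := integralClosure R Ω
  -- A maximal ideal of the integral closure in `Ω` replaces an extension of the valuation to `Ω`.
  obtain ⟨m, hm, hm'⟩ := Ideal.exists_ideal_over_maximal_of_isIntegral (S := I)
    (IsLocalRing.maximalIdeal R) (by
      intro x hx
      have h0 : algebraMap R Ω x = 0 := by
        have := congrArg (algebraMap I Ω) (RingHom.mem_ker.mp hx)
        rwa [← IsScalarTower.algebraMap_apply, map_zero] at this
      rw [(map_eq_zero_iff _ hψ).mp h0]
      exact zero_mem _)
  let B := Module.finBasis K M
  let A : Matrix _ _ K := LinearMap.toMatrix B B X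
  let C : Matrix _ _ K := LinearMap.toMatrix B B Z
  let A' := A.map (algebraMap K Ω)
  let C' := C.map (algebraMap K Ω)
  have hAC : A' ^ N = algebraMap R Ω a • C' := by
    have h1 : A ^ N = φ a • C := by
      simp only [A, C]
      rw [LinearMap.toMatrix_pow, hX, map_smul]
    have h2 := congrArg (fun D : Matrix _ _ K => D.map (algebraMap K Ω)) h1
    simp only [Matrix.map_pow] at h2
    rw [h2]
    ext i j
    simp [C', ψ, RingHom.algebraMap_toAlgebra]
  have hC : aeval C' (P.map (algebraMap R Ω)) = 0 := by
    have h1 : aeval C (P.map φ) = 0 := by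
      have := congrArg (LinearMap.toMatrixAlgEquiv B) hZ
      rw [map_zero, ← aeval_algHom_apply] at this
      exact this
    have h2 := congrArg (RingHom.mapMatrix (algebraMap K Ω)) h1
    rw [map_zero] at h2
    rw [← h2, aeval_def, aeval_def, hom_eval₂]
    have h3 : P.map (algebraMap R Ω) = (P.map φ).map (algebraMap K Ω) := by
      rw [Polynomial.map_map]
      rfl
    rw [h3, eval₂_map]
    congr 1
    ext x i j
    simp [Matrix.algebraMap_matrix_apply]
    split <;> simp
  have hroot : ∀ l ∈ A'.charpoly.roots, ∃ y : I, y ∈ m ∧ (y : Ω) = l := by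
    intro l hl
    have hl' : Module.End.HasEigenvalue (Matrix.toLin' A') l := by
      rw [Module.End.hasEigenvalue_iff_isRoot_charpoly, Matrix.charpoly_toLin']
      exact (mem_roots'.mp hl).2
    obtain ⟨v, hv⟩ := hl'.exists_hasEigenvector
    have hv0 := hv.2
    have h1 : l ^ N • v = algebraMap R Ω a • Matrix.toLin' C' v := by
      rw [← hv.pow_apply, ← Matrix.toLin'_pow, hAC, map_smul, LinearMap.smul_apply]
    -- On an eigenvector of `X`, the operator `Z` acts by `l ^ N / a`, which is a root of the monic
    -- `P`. If `a = 0`, then `l ^ N = 0` and `z = 0` serves.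
    obtain ⟨z, hz, hz'⟩ : ∃ z : Ω, IsIntegral R z ∧ l ^ N = algebraMap R Ω a * z := by
      by_cases ha0 : algebraMap R Ω a = 0
      · refine ⟨0, isIntegral_zero, ?_⟩
        rw [ha0, zero_smul] at h1
        rw [ha0, zero_mul]
        exact (smul_eq_zero.mp h1).resolve_right hv0
      · refine ⟨l ^ N / algebraMap R Ω a, ⟨P, hP, ?_⟩, (mul_div_cancel₀ _ ha0).symm⟩
        have h2 : Module.End.HasEigenvector (Matrix.toLin' C') (l ^ N / algebraMap R Ω a) v := by
          refine ⟨Module.End.mem_eigenspace_iff.mpr ?_, hv0⟩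
          rw [div_eq_inv_mul, mul_smul, h1, smul_smul, inv_mul_cancel₀ ha0, one_smul]
        have h3 := Module.End.aeval_apply_of_hasEigenvector (p := P.map (algebraMap R Ω)) h2
        have h4 : aeval (Matrix.toLin' C') (P.map (algebraMap R Ω)) = 0 := by
          have := congrArg Matrix.toLinAlgEquiv' hC
          rw [map_zero, ← aeval_algHom_apply] at this
          exact this
        rw [h4, LinearMap.zero_apply] at h3
        have h5 := (smul_eq_zero.mp h3.symm).resolve_right hv0
        rwa [eval_map] at h5
    have hlN : IsIntegral R (l ^ N) := by
      rw [hz']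
      exact isIntegral_algebraMap.mul hz
    have hl1 : IsIntegral R l := hlN.of_pow (Nat.pos_of_ne_zero hN)
    refine ⟨⟨l, hl1⟩, ?_, rfl⟩
    have := hm.isPrime
    refine this.mem_of_pow_mem N ?_
    have h6 : (⟨l, hl1⟩ : I) ^ N = algebraMap R I a * ⟨z, hz⟩ := Subtype.ext hz'
    rw [h6]
    refine Ideal.mul_mem_right _ _ ?_
    rw [← Ideal.mem_comap, hm']
    exact ha
  have hsum : (1 : Ω) = A'.charpoly.roots.sum := by
    rw [← Matrix.trace_eq_sum_roots_charpoly]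
    have h1 : A.trace = 1 := by
      rw [← htr, LinearMap.trace_eq_matrix_trace K B]
    have h2 : A'.trace = algebraMap K Ω A.trace := by
      simp [A', Matrix.trace]
    rw [h2, h1, map_one]
  have hmem : ∀ s : Multiset Ω, (∀ l ∈ s, ∃ y : I, y ∈ m ∧ (y : Ω) = l) →
      ∃ y : I, y ∈ m ∧ (y : Ω) = s.sum := by
    intro s
    induction s using Multiset.induction with
    | empty => exact fun _ => ⟨0, zero_mem _, by simp⟩
    | cons x s ih =>
      intro hs
      obtain ⟨y, hy, hy'⟩ := ih fun l hl => hs l (Multiset.mem_cons_of_mem hl)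
      obtain ⟨w, hw, hw'⟩ := hs x (Multiset.mem_cons_self x s)
      exact ⟨w + y, add_mem hw hy, by simp [hy', hw']⟩
  obtain ⟨y, hy, hy'⟩ := hmem _ hroot
  rw [← hsum] at hy'
  have : y = 1 := Subtype.ext hy'
  exact hm.ne_top ((Ideal.eq_top_iff_one _).mpr (this ▸ hy))

end TraceNeOne

/-! ### Traces to intermediate fields -/

section TraceIntermediate

variable {F E : Type*} [Field F] [ValuativeRel F] [TopologicalSpace F]
  [IsNonarchimedeanLocalField F] [Field E] [ValuativeRel E] [TopologicalSpace E]
  [IsNonarchimedeanLocalField E] [Algebra F E] [ValuativeExtension F E] [FiniteDimensional F E]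

/-- The trace to an intermediate field does not increase the absolute value. -/
theorem val_trace_le (E' : IntermediateField F E) (x : E) :
    valuation E (Algebra.trace E' E x : E) ≤ valuation E x := by
  by_contra! hlt
  set t := Algebra.trace E' E x with ht
  have ht0 : (t : E) ≠ 0 := by
    intro h
    rw [h, map_zero] at hlt
    exact not_lt_zero hlt
  have ht0' : t ≠ 0 := fun h => ht0 (by rw [h]; rfl)
  obtain ⟨π, hπ⟩ := IsDiscreteValuationRing.exists_irreducible 𝒪[F]
  obtain ⟨ϖ, hϖ⟩ := IsDiscreteValuationRing.exists_irreducible 𝒪[E]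
  obtain ⟨e, he0, he⟩ := exists_val_eq_pow hπ hϖ
  have hπ0 : algebraMap F E π ≠ 0 := by simpa using irreducible_coe_ne_zero hπ
  -- The scaling gives `z` trace 1 but `valuation E z < 1`, so that `z ^ e` is a uniformizer of `F`
  -- times an integer.
  let z : E := t⁻¹ • x
  have hz : valuation E z < 1 := by
    have h1 : z = (t : E)⁻¹ * x := by simp [z, Algebra.smul_def]
    rw [h1, map_mul, map_inv₀, inv_mul_lt_iff₀ (by simpa [zero_lt_iff] using ht0), mul_one]
    exact hlt
  have hw : valuation E (z ^ e / algebraMap F E π) ≤ 1 := by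
    rw [map_div₀, he, map_pow]
    exact div_le_one_of_le₀ (pow_le_pow_left' ((val_lt_one_iff hϖ).mp hz) e) zero_le
  obtain ⟨P, hP, hPw⟩ := isIntegral_of_val_le_one F hw
  refine trace_ne_one ((algebraMap F E').comp (algebraMap 𝒪[F] F))
    ((algebraMap F E').injective.comp Subtype.val_injective) (Algebra.lmul E' E z)
    (Algebra.lmul E' E (z ^ e / algebraMap F E π)) he0.ne' (a := π)
    ((mem_maximalIdeal_iff π).mpr (val_irreducible_lt_one hπ)) ?_ hP ?_ ?_
  · rw [← map_pow, ← map_smul]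
    congr 1
    rw [Algebra.smul_def]
    exact (mul_div_cancel₀ _ hπ0).symm
  · rw [Polynomial.aeval_algHom_apply]
    have h1 : Polynomial.aeval (z ^ e / algebraMap F E π)
        (P.map ((algebraMap F E').comp (algebraMap 𝒪[F] F))) = 0 := by
      rw [Polynomial.aeval_def, Polynomial.eval₂_map]
      exact hPw
    rw [h1, map_zero]
  · change Algebra.trace E' E z = 1
    rw [map_smul, ← ht, smul_eq_mul, inv_mul_cancel₀ ht0']

end TraceIntermediate

/-! ### Lattice chains as powers of the maximal ideal of `E`, and traces on `𝔓^k` -/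

section Chain

namespace LatticeChain

variable {F V : Type*} [Field F] [ValuativeRel F] [AddCommGroup V] [Module F V]
  (L : LatticeChain F V)

theorem mul_mem_frakP {k l m : ℤ} (hm : m ≤ k + l) {X Y : Module.End F V} (hX : X ∈ L.frakP k)
    (hY : Y ∈ L.frakP l) : X * Y ∈ L.frakP m := by
  intro i v hv
  refine L.strictAnti.antitone (by omega : i + m ≤ i + l + k) ?_
  exact hX _ _ (hY i v hv)

theorem pow_mem_frakP {k : ℤ} {X : Module.End F V} (hX : X ∈ L.frakP k) (n : ℕ) :
    X ^ n ∈ L.frakP (n * k) := by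
  induction n with
  | zero => intro m v hv; simpa using hv
  | succ n ih =>
    rw [pow_succ]
    exact L.mul_mem_frakP (by push_cast; linarith) ih hX

/-- Cayley–Hamilton on the finitely generated module `Λ(0)`, which spans `V`. -/
theorem exists_monic_aeval_eq_zero {X : Module.End F V} (hX : X ∈ L.frakP 0) :
    ∃ P : Polynomial 𝒪[F], P.Monic ∧
      Polynomial.aeval X (P.map (algebraMap 𝒪[F] F)) = 0 := by
  have hX' : ∀ v ∈ L.toFun 0, X v ∈ L.toFun 0 := fun v hv => by simpa using hX 0 v hv
  let f : Module.End 𝒪[F] (L.toFun 0) := (X.restrictScalars 𝒪[F]).restrict hX'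
  have : Module.Finite 𝒪[F] (L.toFun 0) := Module.Finite.iff_fg.mpr (L.fg 0)
  obtain ⟨P, hP, hP0⟩ := LinearMap.exists_monic_and_aeval_eq_zero 𝒪[F] f
  refine ⟨P, hP, ?_⟩
  have hpow : ∀ (n : ℕ) (w : L.toFun 0), (((f ^ n) w : L.toFun 0) : V) = (X ^ n) (w : V) := by
    intro n
    induction n with
    | zero => intro w; rfl
    | succ n ih =>
      intro w
      rw [pow_succ, pow_succ, Module.End.mul_apply, Module.End.mul_apply, ih]
      rfl
  refine LinearMap.ext_on (L.span_eq_top 0) fun w hw => ?_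
  have h1 := congrArg Subtype.val (LinearMap.congr_fun hP0 ⟨w, hw⟩)
  rw [Polynomial.aeval_eq_sum_range] at h1
  rw [Polynomial.aeval_eq_sum_range, Polynomial.natDegree_map_eq_of_injective
    Subtype.val_injective]
  simp only [LinearMap.sum_apply, LinearMap.smul_apply, LinearMap.zero_apply,
    AddSubmonoidClass.coe_finsetSum, Submodule.coe_smul, hpow, ZeroMemClass.coe_zero] at h1
  simpa [LinearMap.sum_apply] using h1

end LatticeChain

variable {F E V : Type*} [Field F] [ValuativeRel F] [TopologicalSpace F]
  [IsNonarchimedeanLocalField F] [Field E] [ValuativeRel E] [TopologicalSpace E]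
  [IsNonarchimedeanLocalField E] [Algebra F E] [ValuativeExtension F E]
  [AddCommGroup V] [Module F V] [Module E V] [IsScalarTower F E V]

/-- `Λ(k) = 𝔭_E^k w` for all `k`, for a generator `w` of `V` over `E`. -/
structure IsGenerator (L : LatticeChain F V) (ϖ : 𝒪[E]) (w : V) : Prop where
  exists_smul : ∀ v : V, ∃ x : E, x • w = v
  smul_mem_iff : ∀ (k : ℤ) (x : E), x • w ∈ L.toFun k ↔ valuation E x ≤ valuation E (ϖ : E) ^ k

/-- The index shift `m : Eˣ → ℤ` is a homomorphism, non-negative on integers and positive on the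
maximal ideal. Strict decrease of the chain then forces `m ϖ = 1`, so the chain is the `ϖ`-adic
filtration, generated by any vector of `Λ(0)` outside `Λ(1)`. -/
theorem exists_isGenerator (hdim : Module.finrank E V = 1) (L : LatticeChain F V)
    (hpure : ∀ x : E, x ≠ 0 → ∃ m : ℤ, ∀ k,
      (L.toFun k).map ((emb F V x).restrictScalars 𝒪[F]) = L.toFun (k + m))
    {ϖ : 𝒪[E]} (hϖ : Irreducible ϖ) : ∃ w : V, w ≠ 0 ∧ IsGenerator L ϖ w := by
  have hϖ0 := irreducible_coe_ne_zero hϖ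
  choose m hm using fun x : Eˣ => hpure x x.ne_zero
  have hmap : ∀ (x : Eˣ) (k : ℤ) (v : V), v ∈ L.toFun k → (x : E) • v ∈ L.toFun (k + m x) := by
    intro x k v hv
    rw [← hm]
    exact ⟨v, hv, rfl⟩
  have hmap' : ∀ (x : Eˣ) (k : ℤ) (v : V), v ∈ L.toFun (k + m x) →
      ∃ w ∈ L.toFun k, (x : E) • w = v := by
    intro x k v hv
    rw [← hm] at hv
    exact hv
  have hmul : ∀ x y : Eˣ, m (x * y) = m x + m y := by
    intro x y
    have h1 : L.toFun (0 + m (x * y)) = L.toFun (0 + m y + m x) := by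
      ext v
      constructor
      · intro hv
        obtain ⟨w, hw, rfl⟩ := hmap' _ _ _ hv
        rw [Units.val_mul, mul_smul]
        exact hmap _ _ _ (hmap _ _ _ hw)
      · intro hv
        obtain ⟨w, hw, rfl⟩ := hmap' _ _ _ hv
        obtain ⟨w', hw', rfl⟩ := hmap' _ _ _ hw
        rw [smul_smul, ← Units.val_mul]
        exact hmap _ _ _ hw'
    have := L.strictAnti.injective h1
    omega
  have hone : m 1 = 0 := by
    have := hmul 1 1
    rw [mul_one] at this
    omega
  have hinv : ∀ x : Eˣ, m x⁻¹ = -m x := by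
    intro x
    have := hmul x x⁻¹
    rw [mul_inv_cancel, hone] at this
    omega
  have hpow : ∀ (x : Eˣ) (n : ℕ), m (x ^ n) = n * m x := by
    intro x n
    induction n with
    | zero => simpa using hone
    | succ n ih =>
      rw [pow_succ, hmul, ih]
      push_cast
      ring
  have hnonneg : ∀ x : Eˣ, valuation E (x : E) ≤ 1 → 0 ≤ m x := by
    intro x hx
    by_contra! hneg
    obtain ⟨P, hP, hPx⟩ := isIntegral_of_val_le_one F hx
    set N := P.natDegree with hN
    have hN0 : N ≠ 0 := by
      intro h0
      rw [hP.natDegree_eq_zero] at h0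
      rw [h0, Polynomial.eval₂_one] at hPx
      exact one_ne_zero hPx
    have hx' : ((x ^ N : Eˣ) : E) = -∑ i ∈ Finset.range N, algebraMap 𝒪[F] E (P.coeff i) * (x : E) ^ i := by
      rw [Polynomial.eval₂_eq_sum_range, Finset.sum_range_succ, ← hN, hP.coeff_natDegree, map_one,
        one_mul, add_comm] at hPx
      rw [Units.val_pow_eq_pow_val]
      exact eq_neg_of_add_eq_zero_left hPx
    -- With `m x < 0`, the integral equation of `x` yields `Λ(N m(x)) ⊆ Λ((N - 1) m(x))`, against
    -- strict decrease.
    have hle : L.toFun (0 + m (x ^ N)) ≤ L.toFun ((N - 1) * m x) := by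
      intro v hv
      obtain ⟨w, hw, rfl⟩ := hmap' _ _ _ hv
      rw [hx', neg_smul, Finset.sum_smul]
      refine neg_mem (Submodule.sum_mem _ fun i hi => ?_)
      have h2 : (algebraMap 𝒪[F] E (P.coeff i) * (x : E) ^ i) • w =
          P.coeff i • ((x ^ i : Eˣ) : E) • w := by
        rw [mul_smul, Units.val_pow_eq_pow_val]
        exact algebraMap_smul E ((P.coeff i : 𝒪[F]) : F) _
      rw [h2]
      refine Submodule.smul_mem _ _ (L.strictAnti.antitone ?_ (hmap _ _ _ hw))
      rw [hpow, zero_add]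
      have h3 : (i : ℤ) ≤ N - 1 := by
        have := Finset.mem_range.mp hi
        omega
      exact mul_le_mul_of_nonpos_right h3 hneg.le
    rw [L.strictAnti.le_iff_ge, hpow] at hle
    linarith
  have hpos : ∀ x : Eˣ, valuation E (x : E) < 1 → 1 ≤ m x := by
    intro x hx
    obtain ⟨π, hπ⟩ := IsDiscreteValuationRing.exists_irreducible 𝒪[F]
    obtain ⟨e, he0, he⟩ := exists_val_eq_pow hπ hϖ
    have hπ0 : algebraMap F E π ≠ 0 := by simpa using irreducible_coe_ne_zero hπ
    let p : Eˣ := Units.mk0 _ hπ0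
    have hp : 0 < m p := by
      obtain ⟨e₀, he₀, hper⟩ := L.periodic
      have hle : L.toFun (0 + m p) ≤ L.toFun (0 + e₀) := by
        intro v hv
        obtain ⟨w, hw, rfl⟩ := hmap' _ _ _ hv
        rw [← hper]
        have : (p : E) • w = π • w := algebraMap_smul E (π : F) w
        rw [this]
        exact Submodule.smul_mem_smul
          ((mem_maximalIdeal_iff π).mpr (val_irreducible_lt_one hπ)) hw
      rw [L.strictAnti.le_iff_ge] at hle
      omega
    -- `x ^ e` is an integer times `π`, and `π` shifts by a positive amount because `𝔭_F Λ(0)` is a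
    -- later lattice of the chain.
    have hu : 0 ≤ m (x ^ e * p⁻¹) := by
      refine hnonneg _ ?_
      have : ((x ^ e * p⁻¹ : Eˣ) : E) = (x : E) ^ e / algebraMap F E π := by
        simp [p, div_eq_mul_inv]
      rw [this, map_div₀, he, map_pow]
      exact div_le_one_of_le₀ (pow_le_pow_left' ((val_lt_one_iff hϖ).mp hx) e) zero_le
    rw [hmul, hinv, hpow] at hu
    have h4 : 0 < (e : ℤ) * m x := by omega
    have := pos_of_mul_pos_right h4 (by positivity)
    omega
  obtain ⟨w, hw0, hw1⟩ := Set.exists_of_ssubset (L.strictAnti (zero_lt_one (α := ℤ)))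
  have hwne : w ≠ 0 := by
    rintro rfl
    exact hw1 (zero_mem _)
  have hex : ∀ v : V, ∃ x : E, x • w = v := (finrank_eq_one_iff_of_nonzero' w hwne).mp hdim
  have hzero : ∀ x : E, x • w ∈ L.toFun 0 ↔ valuation E x ≤ 1 := by
    intro x
    by_cases hx : x = 0
    · simp [hx]
    constructor
    · intro h
      by_contra! hlt
      have h1 := hpos (Units.mk0 x hx)⁻¹ (by
        rw [Units.val_inv_eq_inv_val, Units.val_mk0, map_inv₀]
        exact inv_lt_one_of_one_lt₀ hlt)
      have h2 := hmap (Units.mk0 x hx)⁻¹ _ _ h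
      rw [smul_smul, Units.val_inv_eq_inv_val, Units.val_mk0, inv_mul_cancel₀ hx, one_smul] at h2
      exact hw1 (L.strictAnti.antitone (by omega) h2)
    · intro h
      have h1 := hnonneg (Units.mk0 x hx) h
      exact L.strictAnti.antitone (by omega) (hmap (Units.mk0 x hx) 0 w hw0)
  let p : Eˣ := Units.mk0 (ϖ : E) hϖ0
  have hp : m p = 1 := by
    have h1 : 1 ≤ m p := hpos p (val_irreducible_lt_one hϖ)
    -- A vector `x • w` of `Λ(1)` has `x` a non-unit, since a unit would bring `w` into `Λ(1)`;
    -- hence it lies in `ϖ Λ(0)`.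
    have hle : L.toFun 1 ≤ L.toFun (0 + m p) := by
      intro v hv
      obtain ⟨x, rfl⟩ := hex v
      have hx1 : valuation E x ≤ 1 :=
        (hzero x).mp (L.strictAnti.antitone (by omega) hv)
      have hx2 : valuation E x < 1 := by
        refine lt_of_le_of_ne hx1 fun heq => ?_
        have hx0 : x ≠ 0 := by
          rintro rfl
          simp at heq
        have h2 := hnonneg (Units.mk0 x hx0)⁻¹ (by
          rw [Units.val_inv_eq_inv_val, Units.val_mk0, map_inv₀, heq, inv_one])
        have h3 := hmap (Units.mk0 x hx0)⁻¹ _ _ hv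
        rw [smul_smul, Units.val_inv_eq_inv_val, Units.val_mk0, inv_mul_cancel₀ hx0,
          one_smul] at h3
        exact hw1 (L.strictAnti.antitone (by omega) h3)
      have h4 : x • w = (p : E) • ((ϖ : E)⁻¹ * x) • w := by
        rw [smul_smul, Units.val_mk0, mul_inv_cancel_left₀ hϖ0]
      rw [h4]
      refine hmap _ _ _ ((hzero _).mpr ?_)
      rw [map_mul, map_inv₀, inv_mul_le_iff₀ (Valuation.integer.v_irreducible_pos hϖ), mul_one]
      exact (val_lt_one_iff hϖ).mp hx2
    rw [L.strictAnti.le_iff_ge] at hle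
    omega
  have hshift : ∀ (k : ℤ) (n : ℕ) (v : V), (ϖ : E) ^ n • v ∈ L.toFun (k + n) ↔ v ∈ L.toFun k := by
    intro k n v
    have h1 : m (p ^ n) = n := by rw [hpow, hp, mul_one]
    have h2 : ((p ^ n : Eˣ) : E) = (ϖ : E) ^ n := by simp [p]
    rw [← h1, ← h2]
    refine ⟨fun hv => ?_, hmap _ _ _⟩
    obtain ⟨v', hv', h⟩ := hmap' _ _ _ hv
    rw [← smul_right_injective V (p ^ n).ne_zero h]
    exact hv'
  refine ⟨w, hwne, hex, fun k x => ?_⟩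
  rcases le_total 0 k with hk | hk
  · obtain ⟨n, rfl⟩ := Int.eq_ofNat_of_zero_le hk
    have h1 := hshift 0 n (((ϖ : E) ^ n)⁻¹ • x • w)
    rw [smul_smul, mul_inv_cancel₀ (pow_ne_zero _ hϖ0), one_smul, zero_add, smul_smul,
      hzero] at h1
    rw [h1, map_mul, map_inv₀, map_pow, zpow_natCast,
      inv_mul_le_iff₀ (pow_pos (Valuation.integer.v_irreducible_pos hϖ) n), mul_one]
  · obtain ⟨n, hn⟩ := Int.eq_ofNat_of_zero_le (neg_nonneg.mpr hk)
    have hk' : k = -n := by omega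
    have h1 := hshift k n (x • w)
    rw [show k + n = 0 by omega, smul_smul, hzero] at h1
    rw [← h1, map_mul, map_pow, hk', zpow_neg, zpow_natCast,
      ← le_inv_mul_iff₀ (pow_pos (Valuation.integer.v_irreducible_pos hϖ) n), mul_one]

omit [TopologicalSpace F] [IsNonarchimedeanLocalField F] in
-- If the trace were not integral, dividing `X` by it would give trace 1 to an element of `𝔭_F`
-- times the integral operator `X`.
theorem LatticeChain.val_trace_le_one {L : LatticeChain F V} [FiniteDimensional F V]
    {X : Module.End F V} (hX : X ∈ L.frakP 0) : valuation F (LinearMap.trace F V X) ≤ 1 := by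
  by_contra! h
  have h0 : LinearMap.trace F V X ≠ 0 := by
    intro h0
    rw [h0, map_zero] at h
    exact not_lt_zero h
  have h1 : valuation F (LinearMap.trace F V X)⁻¹ < 1 := by
    rw [map_inv₀]
    exact inv_lt_one_of_one_lt₀ h
  obtain ⟨P, hP, hP0⟩ := L.exists_monic_aeval_eq_zero hX
  refine trace_ne_one (algebraMap 𝒪[F] F) Subtype.val_injective
    ((LinearMap.trace F V X)⁻¹ • X) X one_ne_zero
    ((mem_maximalIdeal_iff ⟨_, h1.le⟩).mpr h1) (pow_one _) hP hP0 ?_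
  rw [map_smul, smul_eq_mul, inv_mul_cancel₀ h0]

namespace IsGenerator

variable {L : LatticeChain F V} {ϖ : 𝒪[E]} {w : V} (hw : IsGenerator L ϖ w)
include hw

omit [TopologicalSpace F] [IsNonarchimedeanLocalField F] [TopologicalSpace E]
  [IsNonarchimedeanLocalField E] [ValuativeExtension F E] in
theorem emb_mem_frakP (hϖ : Irreducible ϖ) {x : E} {k : ℤ}
    (hx : valuation E x ≤ valuation E (ϖ : E) ^ k) : emb F V x ∈ L.frakP k := by
  intro m v hv
  obtain ⟨y, rfl⟩ := hw.exists_smul v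
  rw [hw.smul_mem_iff] at hv
  have h1 : emb F V x (y • w) = (x * y) • w := by
    rw [mul_smul]
    rfl
  rw [h1, hw.smul_mem_iff, map_mul, add_comm, zpow_add₀ (val_irreducible_ne_zero hϖ)]
  exact mul_le_mul' hx hv

/-- `X ^ e ∈ 𝔓^e = π 𝔓^0`, since multiplication by `π` shifts the chain by `e = e(E/F)`. -/
theorem trace_ne_one_of_mem_frakP (hϖ : Irreducible ϖ) [FiniteDimensional F V]
    {X : Module.End F V} (hX : X ∈ L.frakP 1) : LinearMap.trace F V X ≠ 1 := by
  obtain ⟨π, hπ⟩ := IsDiscreteValuationRing.exists_irreducible 𝒪[F]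
  obtain ⟨e, he0, he⟩ := exists_val_eq_pow hπ hϖ
  have hπ0 := irreducible_coe_ne_zero hπ
  have hπE : emb F V ((algebraMap F E π)⁻¹) ∈ L.frakP (-e) := by
    refine hw.emb_mem_frakP hϖ ?_
    rw [map_inv₀, he, zpow_neg, zpow_natCast]
  obtain ⟨P, hP, hP0⟩ := L.exists_monic_aeval_eq_zero
    (L.mul_mem_frakP (m := 0) (by omega) hπE (L.pow_mem_frakP hX e))
  refine trace_ne_one (algebraMap 𝒪[F] F) Subtype.val_injective X _ he0.ne'
    ((mem_maximalIdeal_iff π).mpr (val_irreducible_lt_one hπ)) ?_ hP hP0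
  ext v
  rw [LinearMap.smul_apply, Module.End.mul_apply]
  change _ = (π : F) • (algebraMap F E π)⁻¹ • (X ^ e) v
  rw [← algebraMap_smul E (π : F), smul_smul, mul_inv_cancel₀ (by simpa using hπ0), one_smul]

theorem val_trace_lt_one (hϖ : Irreducible ϖ) [FiniteDimensional F V]
    {X : Module.End F V} (hX : X ∈ L.frakP 1) : valuation F (LinearMap.trace F V X) < 1 := by
  by_contra! h
  have h0 : LinearMap.trace F V X ≠ 0 := by
    intro h0
    rw [h0, map_zero] at h
    exact not_lt_zero (lt_of_lt_of_le one_pos h)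
  have h1 : valuation F (LinearMap.trace F V X)⁻¹ ≤ 1 := by
    rw [map_inv₀]
    exact inv_le_one_of_one_le₀ h
  refine hw.trace_ne_one_of_mem_frakP hϖ
    ((L.frakP 1).smul_mem (⟨_, h1⟩ : 𝒪[F]) hX) ?_
  change LinearMap.trace F V ((LinearMap.trace F V X)⁻¹ • X) = 1
  rw [map_smul, smul_eq_mul, inv_mul_cancel₀ h0]

end IsGenerator

end Chain

/-! ### Duality of lattices for the trace pairing -/

section Duality

/-- The operator factors through `E'`; by cyclicity its trace is that of multiplication by
`Tr_{E/E'}(b)` on `E'`, and traces are transitive. -/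
theorem trace_comp_trace_mul {F E : Type*} [Field F] [Field E] [Algebra F E] [FiniteDimensional F E]
    (E' : IntermediateField F E) (b : E) :
    LinearMap.trace F E ((IsScalarTower.toAlgHom F E' E).toLinearMap ∘ₗ
      ((Algebra.trace E' E).restrictScalars F ∘ₗ LinearMap.mulLeft F b)) =
      Algebra.trace F E b := by
  rw [LinearMap.trace_comp_comm', ← Algebra.trace_trace (S := E'), Algebra.trace_apply]
  congr 1
  ext a
  change ((Algebra.trace E' E (b * algebraMap E' E a) : E') : E) = _
  rw [mul_comm, ← Algebra.smul_def, map_smul, smul_eq_mul, mul_comm]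
  rfl

variable {F E V : Type*} [Field F] [ValuativeRel F] [TopologicalSpace F]
  [IsNonarchimedeanLocalField F] [Field E] [ValuativeRel E] [TopologicalSpace E]
  [IsNonarchimedeanLocalField E] [Algebra F E] [ValuativeExtension F E] [FiniteDimensional F E]
  [AddCommGroup V] [Module F V] [Module E V] [IsScalarTower F E V]

/-- Duality for the trace form on the centralizer of an intermediate field. -/
theorem IsGenerator.mem_frakP_of_val_trace_lt_one {L : LatticeChain F V} {ϖ : 𝒪[E]} {w : V}
    (hw : IsGenerator L ϖ w) (hϖ : Irreducible ϖ) {b : E} (hb : valuation E b ≤ 1)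
    (hb' : valuation F (Algebra.trace F E b) = 1) (E' : IntermediateField F E) {k : ℤ}
    {Z : Module.End F V} (hZ : ∀ x ∈ E', emb F V x * Z = Z * emb F V x)
    (htr : ∀ Y ∈ L.frakP k, (∀ x ∈ E', emb F V x * Y = Y * emb F V x) →
      valuation F (LinearMap.trace F V (Z * Y)) < 1) : Z ∈ L.frakP (1 - k) := by
  intro i v hv
  by_contra hn
  have hZv : Z v ≠ 0 := by
    intro h
    exact hn (h ▸ zero_mem _)
  obtain ⟨x₀, hx₀⟩ := hw.exists_smul (Z v)
  obtain ⟨z, rfl⟩ := hw.exists_smul v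
  have hx₀0 : x₀ ≠ 0 := by
    rintro rfl
    exact hZv (by rw [← hx₀, zero_smul])
  obtain ⟨l, hl⟩ := exists_val_eq_zpow hϖ hx₀0
  -- By contraposition: `Z v` lies outside `Λ(i + 1 - k)`, and a test operator `Y` is built whose
  -- pairing with `Z` is a unit.
  have hli : l ≤ i - k := by
    rw [← hx₀, hw.smul_mem_iff, hl, val_zpow_le_iff hϖ] at hn
    omega
  rw [hw.smul_mem_iff] at hv
  let ψ : E ≃ₗ[F] V := LinearEquiv.ofBijective
    ((LinearMap.toSpanSingleton E V (Z (z • w))).restrictScalars F) ⟨by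
      intro x y hxy
      exact smul_left_injective E hZv hxy, by
      intro u
      obtain ⟨y, rfl⟩ := hw.exists_smul u
      refine ⟨y * x₀⁻¹, ?_⟩
      change (y * x₀⁻¹) • Z (z • w) = _
      rw [← hx₀, smul_smul, inv_mul_cancel_right₀ hx₀0]⟩
  have hψ : ∀ x, ψ x = x • Z (z • w) := fun x => rfl
  let τ : E →ₗ[F] E := (IsScalarTower.toAlgHom F E' E).toLinearMap ∘ₗ
      ((Algebra.trace E' E).restrictScalars F ∘ₗ LinearMap.mulLeft F b)
  have hτ : ∀ x, τ x = (Algebra.trace E' E (b * x) : E) := fun x => rfl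
  -- `Y` sends `x • Z v` to `Tr_{E/E'}(b x) • v`. It is `E'`-linear, and it lies in `𝔓^k` because
  -- the trace does not increase the absolute value.
  let Y : Module.End F V :=
    ((LinearMap.toSpanSingleton E V (z • w)).restrictScalars F) ∘ₗ τ ∘ₗ ψ.symm.toLinearMap
  have hY : ∀ x, Y (ψ x) = τ x • z • w := by
    intro x
    change τ (ψ.symm (ψ x)) • z • w = _
    rw [LinearEquiv.symm_apply_apply]
  refine (htr Y ?_ ?_).ne ?_
  · intro m u hu
    obtain ⟨x, rfl⟩ := ψ.surjective u
    rw [hY, smul_smul, hw.smul_mem_iff]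
    rw [hψ, ← hx₀, smul_smul, hw.smul_mem_iff, map_mul, hl] at hu
    have h1 : valuation E x ≤ valuation E (ϖ : E) ^ (m - l) := by
      rw [zpow_sub₀ (val_irreducible_ne_zero hϖ)]
      exact (le_div_iff₀ (zpow_pos (Valuation.integer.v_irreducible_pos hϖ) l)).mpr hu
    have h2 : valuation E (τ x) ≤ valuation E (ϖ : E) ^ (m - l) := by
      rw [hτ]
      refine (val_trace_le E' _).trans ?_
      rw [map_mul]
      exact (mul_le_of_le_one_left' hb).trans h1
    rw [map_mul]
    refine (mul_le_mul' h2 hv).trans ?_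
    rw [← zpow_add₀ (val_irreducible_ne_zero hϖ), val_zpow_le_iff hϖ]
    omega
  · intro a ha
    ext u
    obtain ⟨x, rfl⟩ := ψ.surjective u
    have h1 : emb F V a (ψ x) = ψ (a * x) := by
      rw [hψ, hψ, mul_smul]
      rfl
    rw [Module.End.mul_apply, Module.End.mul_apply, h1, hY, hY]
    have h2 : τ (a * x) = a * τ x := by
      rw [hτ, hτ]
      have h3 : b * (a * x) = (⟨a, ha⟩ : E') • (b * x) := by
        rw [Algebra.smul_def]
        change _ = a * (b * x)
        ring
      rw [h3, map_smul]
      rfl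
    rw [h2, mul_smul]
    rfl
  -- As `Z` commutes with `E'`, the product sends `x • Z v` to `τ x • Z v`, so its trace is
  -- `Tr_{E/F}(b)`, a unit.
  · have h1 : Z * Y = ψ.conj τ := by
      ext u
      obtain ⟨x, rfl⟩ := ψ.surjective u
      rw [Module.End.mul_apply, hY, LinearEquiv.conj_apply_apply, LinearEquiv.symm_apply_apply,
        hψ]
      have h2 := LinearMap.congr_fun (hZ (τ x) (Algebra.trace E' E (b * x)).2) (z • w)
      exact h2.symm
    rw [h1, LinearMap.trace_conj', trace_comp_trace_mul, hb']

end Duality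

/-! ### Conjugation in ramified quadratic extensions -/

section Quadratic

variable {K₀ K : Type*} [Field K₀] [ValuativeRel K₀] [TopologicalSpace K₀]
  [IsNonarchimedeanLocalField K₀] [Field K] [ValuativeRel K] [TopologicalSpace K]
  [IsNonarchimedeanLocalField K] [Algebra K₀ K] [ValuativeExtension K₀ K]

theorem val_algHom_le_one (τ : K →ₐ[K₀] K) {x : K} (hx : valuation K x ≤ 1) :
    valuation K (τ x) ≤ 1 := by
  have hext : (valuation K₀).HasExtension (valuation K) :=
    ⟨fun x y => val_algebraMap_le_iff.symm⟩
  have h1 : IsIntegral 𝒪[K₀] (τ x) :=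
    (isIntegral_of_val_le_one K₀ hx).map (τ.restrictScalars 𝒪[K₀])
  have h2 : IsIntegral 𝒪[K] (τ x) := h1.tower_top
  exact Valuation.Integers.mem_of_integral (Valuation.integer.integers (valuation K)) h2

/-- `x ^ e` is an integer times a uniformizer of `K₀`, which `τ` fixes. -/
theorem val_algHom_lt_one (τ : K →ₐ[K₀] K) {x : K} (hx : valuation K x < 1) :
    valuation K (τ x) < 1 := by
  obtain ⟨π, hπ⟩ := IsDiscreteValuationRing.exists_irreducible 𝒪[K₀]
  obtain ⟨ϖ, hϖ⟩ := IsDiscreteValuationRing.exists_irreducible 𝒪[K]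
  obtain ⟨e, he0, he⟩ := exists_val_eq_pow hπ hϖ
  have hπ0 : algebraMap K₀ K π ≠ 0 := by simpa using irreducible_coe_ne_zero hπ
  have h1 : valuation K (x ^ e / algebraMap K₀ K π) ≤ 1 := by
    rw [map_div₀, he, map_pow]
    exact div_le_one_of_le₀ (pow_le_pow_left' ((val_lt_one_iff hϖ).mp hx) e) zero_le
  have h2 : τ x ^ e = τ (x ^ e / algebraMap K₀ K π) * algebraMap K₀ K π := by
    rw [map_div₀, τ.commutes, div_mul_cancel₀ _ hπ0, map_pow]
  have h3 : valuation K (τ x) ^ e < 1 := by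
    rw [← map_pow, h2]
    exact val_mul_lt_one (val_algHom_le_one τ h1)
      (val_algebraMap_lt_one_iff.mpr (val_irreducible_lt_one hπ))
  by_contra! h
  exact not_le.mpr h3 (one_le_pow_of_one_le' h e)

omit [ValuativeRel K₀] [TopologicalSpace K₀] [IsNonarchimedeanLocalField K₀] [TopologicalSpace K]
  [IsNonarchimedeanLocalField K] [ValuativeExtension K₀ K] in
/-- In a ramified quadratic extension the residue fields agree. -/
theorem exists_val_sub_algebraMap_lt_one (hdim : Module.finrank K₀ K = 2)
    (hram : ramIdx K₀ K = 2) {x : K} (hx : valuation K x ≤ 1) :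
    ∃ a : K₀, valuation K (x - algebraMap K₀ K a) < 1 := by
  -- If `t` has a value outside the value group of `K₀`, then `1, t` is a basis and the two terms of
  -- `a + b t` never have equal value. Integrality of the sum bounds both, and `b t` is not a unit.
  obtain ⟨t, ht0, ht⟩ : ∃ t : K, t ≠ 0 ∧ ∀ a : K₀, valuation K (algebraMap K₀ K a) ≠ valuation K t := by
    by_contra! h
    have h1 : (Units.map ((valuation K).toMonoidWithZeroHom.toMonoidHom.comp
        (algebraMap K₀ K).toMonoidHom)).range = ⊤ := by
      rw [MonoidHom.range_eq_top]
      intro g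
      obtain ⟨y, hy⟩ := valuation_surjective (g : ValueGroupWithZero K)
      have hy0 : y ≠ 0 := by
        rintro rfl
        exact g.ne_zero (by rw [← hy, map_zero])
      obtain ⟨a, ha⟩ := h y hy0
      have ha0 : a ≠ 0 := by
        rintro rfl
        rw [map_zero, map_zero] at ha
        exact hy0 ((map_eq_zero _).mp ha.symm)
      exact ⟨Units.mk0 a ha0, Units.ext (by simpa [hy] using ha)⟩
    unfold ramIdx at hram
    rw [h1, Subgroup.index_top] at hram
    omega
  have hne : ∀ a b : K₀, b ≠ 0 → valuation K (algebraMap K₀ K a) ≠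
      valuation K (algebraMap K₀ K b * t) := by
    intro a b hb h
    refine ht (a / b) ?_
    rw [map_div₀, map_div₀, h, map_mul, mul_div_cancel_left₀]
    simpa using hb
  have : FiniteDimensional K₀ K := FiniteDimensional.of_finrank_pos (by omega)
  have hli : LinearIndependent K₀ ![(1 : K), t] := by
    rw [LinearIndependent.pair_iff]
    intro a b hab
    have hb : b = 0 := by
      by_contra hb
      refine hne (-a) b hb ?_
      rw [Algebra.smul_def, Algebra.smul_def, mul_one] at hab
      rw [map_neg, ← eq_neg_of_add_eq_zero_right hab]
    refine ⟨?_, hb⟩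
    simpa [hb] using hab
  have hspan := hli.span_eq_top_of_card_eq_finrank' (by simp [hdim])
  have hxs : x ∈ Submodule.span K₀ (Set.range ![(1 : K), t]) := hspan ▸ Submodule.mem_top
  rw [Matrix.range_cons, Matrix.range_cons, Matrix.range_empty, Set.union_empty,
    Set.singleton_union, Submodule.mem_span_pair] at hxs
  obtain ⟨a, b, rfl⟩ := hxs
  rw [Algebra.smul_def, Algebra.smul_def, mul_one] at hx ⊢
  refine ⟨a, ?_⟩
  rw [add_sub_cancel_left]
  by_cases hb : b = 0
  · simp [hb]
  rw [Valuation.map_add_of_distinct_val _ (hne a b hb)] at hx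
  refine lt_of_le_of_ne ((le_max_right _ _).trans hx) fun h => ?_
  refine hne 1 b hb ?_
  rw [h, map_one, map_one]

theorem val_algHom_sub_lt_one (hdim : Module.finrank K₀ K = 2) (hram : ramIdx K₀ K = 2)
    (τ : K →ₐ[K₀] K) {x : K} (hx : valuation K x ≤ 1) : valuation K (τ x - x) < 1 := by
  obtain ⟨a, ha⟩ := exists_val_sub_algebraMap_lt_one hdim hram hx
  have h1 : τ x - x = τ (x - algebraMap K₀ K a) - (x - algebraMap K₀ K a) := by
    rw [map_sub, τ.commutes]
    ring
  rw [h1]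
  exact Valuation.map_sub_lt _ (val_algHom_lt_one τ ha) ha

end Quadratic

/-! ### Algebra of the adjoint involution -/

section Adjoint

variable {F V : Type*} [Field F] [AddCommGroup V] [Module F V] [FiniteDimensional F V]
  {c : F →+* F} {h : V →ₗ[F] V →ₛₗ[c] F}

section

variable (hc : Function.Surjective c) (hh : h.SeparatingRight)
include hc hh

theorem conjAdjoint_mul (X Y : Module.End F V) :
    conjAdjoint h (X * Y) = conjAdjoint h Y * conjAdjoint h X := by
  refine (eq_conjAdjoint h hc hh fun v w => ?_).symm
  rw [Module.End.mul_apply, Module.End.mul_apply, apply_conjAdjoint h hc hh,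
    apply_conjAdjoint h hc hh]

theorem conjAdjoint_add (X Y : Module.End F V) :
    conjAdjoint h (X + Y) = conjAdjoint h X + conjAdjoint h Y := by
  refine (eq_conjAdjoint h hc hh fun v w => ?_).symm
  rw [LinearMap.add_apply, LinearMap.add_apply, map_add, map_add, LinearMap.add_apply,
    apply_conjAdjoint h hc hh, apply_conjAdjoint h hc hh]

theorem conjAdjoint_smul (hcc : ∀ a, c (c a) = a) (a : F) (X : Module.End F V) :
    conjAdjoint h (a • X) = c a • conjAdjoint h X := by
  refine (eq_conjAdjoint h hc hh fun v w => ?_).symm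
  rw [LinearMap.smul_apply, LinearMap.smul_apply, map_smul, LinearMap.smul_apply, map_smulₛₗ,
    apply_conjAdjoint h hc hh, hcc]

theorem conjAdjoint_one : conjAdjoint h 1 = 1 :=
  (eq_conjAdjoint h hc hh fun _ _ => rfl).symm

theorem conjAdjoint_neg (X : Module.End F V) : conjAdjoint h (-X) = -conjAdjoint h X := by
  refine (eq_conjAdjoint h hc hh fun v w => ?_).symm
  rw [LinearMap.neg_apply, LinearMap.neg_apply, map_neg, map_neg, LinearMap.neg_apply,
    apply_conjAdjoint h hc hh]

theorem conjAdjoint_sub (X Y : Module.End F V) :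
    conjAdjoint h (X - Y) = conjAdjoint h X - conjAdjoint h Y := by
  rw [sub_eq_add_neg, conjAdjoint_add hc hh, conjAdjoint_neg hc hh, sub_eq_add_neg]

variable {ε : F} (hε : ε = 1 ∨ ε = -1) (hherm : ∀ v w, h w v = ε * c (h v w))
  (hcc : ∀ a, c (c a) = a)
include hε hherm hcc

theorem conjAdjoint_conjAdjoint (X : Module.End F V) :
    conjAdjoint h (conjAdjoint h X) = X := by
  refine (eq_conjAdjoint h hc hh fun v w => ?_).symm
  rw [hherm w, ← apply_conjAdjoint h hc hh, hherm v, map_mul, hcc]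
  rcases hε with rfl | rfl <;> simp

omit hcc in
-- By additivity it suffices to treat rank-one operators `φ ⊗ v`. With `φ = h(·, w)`, the adjoint is
-- the rank-one operator `ε h(·, v) ⊗ w`.
theorem trace_conjAdjoint (X : Module.End F V) :
    LinearMap.trace F V (conjAdjoint h X) = c (LinearMap.trace F V X) := by
  have hcε : c ε = ε := by rcases hε with rfl | rfl <;> simp
  have hεε : ε * ε = 1 := by rcases hε with rfl | rfl <;> simp
  rcases subsingleton_or_nontrivial V with hV | hV
  · have h0 : ∀ Z : Module.End F V, Z = 0 := fun Z => by
      ext v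
      exact Subsingleton.elim _ _
    rw [h0 (conjAdjoint h X), h0 X]
    simp
  obtain ⟨v₁, w₁, h1⟩ : ∃ v₁ w₁, h v₁ w₁ = 1 := by
    obtain ⟨w, hw⟩ := exists_ne (0 : V)
    obtain ⟨v, hv⟩ : ∃ v, h v w ≠ 0 := by
      by_contra! hcon
      exact hw (hh w hcon)
    exact ⟨(h v w)⁻¹ • v, w, by simp [hv]⟩
  -- Since `h v₁ w₁ = 1`, the adjoint of `φ ⊗ v₁` applied to `w₁` represents `φ`.
  have hrep : ∀ φ : V →ₗ[F] F, ∃ w, ∀ v, h v w = φ v := by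
    intro φ
    refine ⟨conjAdjoint h (φ.smulRight v₁) w₁, fun v => ?_⟩
    rw [← apply_conjAdjoint h hc hh]
    simp [h1]
  have hrank : ∀ (φ : V →ₗ[F] F) (v : V),
      LinearMap.trace F V (conjAdjoint h (φ.smulRight v)) =
        c (LinearMap.trace F V (φ.smulRight v)) := by
    intro φ v
    obtain ⟨w, hw⟩ := hrep φ
    have h2 : (ε • h.flip v : V →ₗ[F] F).smulRight w = conjAdjoint h (φ.smulRight v) := by
      refine eq_conjAdjoint h hc hh fun v' z => ?_
      have h3 : h v z = ε * c (h z v) := hherm z v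
      simp [h3, ← hw, hcε]
      ring
    rw [← h2, LinearMap.trace_smulRight, LinearMap.trace_smulRight, ← hw v]
    have h4 : h w v = ε * c (h v w) := hherm v w
    simp [h4, ← mul_assoc, hεε]
  let B := Module.finBasis F V
  have hX : X = ∑ i, (B.coord i).smulRight (X (B i)) := by
    refine B.ext fun j => ?_
    simp [LinearMap.sum_apply, Finsupp.single_apply]
  have hsum : ∀ s : Finset (Fin (Module.finrank F V)),
      LinearMap.trace F V (conjAdjoint h (∑ i ∈ s, (B.coord i).smulRight (X (B i)))) =
        c (LinearMap.trace F V (∑ i ∈ s, (B.coord i).smulRight (X (B i)))) := by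
    classical
    intro s
    induction s using Finset.induction_on with
    | empty =>
      have h0 : conjAdjoint h (0 : Module.End F V) = 0 := by
        simpa using conjAdjoint_sub hc hh (0 : Module.End F V) 0
      simp [h0]
    | insert i s his ih =>
      rw [Finset.sum_insert his, conjAdjoint_add hc hh, map_add, map_add, map_add, ih, hrank]
  rw [hX]
  exact hsum _

omit hcc in
-- `X` maps `Λ(m-i-k)` into `Λ(m-i)`; dually the adjoint maps `Λ(i)` into `Λ(i+k)`.
theorem conjAdjoint_mem_frakP [ValuativeRel F] (L : LatticeChain F V)
    (hself : ∃ m : ℤ, ∀ k v, v ∈ L.toFun (m - k) ↔ ∀ w ∈ L.toFun k, valuation F (h v w) < 1)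
    (hcval : ∀ a, valuation F a < 1 → valuation F (c a) < 1) {k : ℤ} {X : Module.End F V}
    (hX : X ∈ L.frakP k) : conjAdjoint h X ∈ L.frakP k := by
  obtain ⟨m, hm⟩ := hself
  intro i w hw
  rw [show i + k = m - (m - i - k) by ring, hm]
  intro v hv
  have hval : valuation F ε = 1 := by rcases hε with rfl | rfl <;> simp
  rw [hherm v, ← apply_conjAdjoint h hc hh, map_mul, hval, one_mul]
  refine hcval _ ?_
  have h1 := hX _ v hv
  rw [show m - i - k + k = m - i by ring, hm] at h1
  exact h1 w hw

end

end Adjoint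

/-! ### Rigidity of roots of unity of order prime to the residual characteristic -/

section Units

variable {E : Type*} [Field E] [ValuativeRel E]

/-- In `z ^ N - 1 = (z - 1)(1 + z + ⋯ + z ^ (N-1))` the second factor is congruent to `N`, a unit.
-/
theorem eq_one_of_pow_eq_one {z : E} {N : ℕ} (hz : z ^ N = 1) (hN : valuation E (N : E) = 1)
    (h1 : valuation E (z - 1) < 1) : z = 1 := by
  have hz1 : valuation E z ≤ 1 := by
    have : z = (z - 1) + 1 := by ring
    rw [this]
    exact Valuation.map_add_le _ h1.le (by simp)
  have hpow : ∀ i : ℕ, valuation E (z ^ i - 1) < 1 := by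
    intro i
    rw [← geom_sum_mul]
    refine val_mul_lt_one (val_sum_le _ _ fun j _ => ?_) h1
    rw [map_pow]
    exact pow_le_one' hz1 j
  have h2 : ∑ i ∈ Finset.range N, z ^ i = (N : E) + ∑ i ∈ Finset.range N, (z ^ i - 1) := by
    simp
  have h3 : valuation E (∑ i ∈ Finset.range N, z ^ i) = 1 := by
    rw [h2, Valuation.map_add_eq_of_lt_left, hN]
    rw [hN]
    exact Valuation.map_sum_lt _ one_ne_zero fun i _ => hpow i
  have h4 := geom_sum_mul z N
  rw [hz, sub_self] at h4
  rcases mul_eq_zero.mp h4 with h5 | h5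
  · rw [h5, map_zero] at h3
    exact absurd h3 zero_ne_one
  · exact sub_eq_zero.mp h5

end Units

/-! ### The norm in a quadratic extension -/

section QuadraticNorm

/-- In a quadratic extension with an involution `σ` whose fixed field is the base field, a
non-fixed element has norm `x σ(x)`. -/
theorem norm_eq_mul_conj {E₀ E : Type*} [Field E₀] [Field E] [Algebra E₀ E]
    (hE : Module.finrank E₀ E = 2) (σ : E →+* E) (hσ : ∀ x, σ (σ x) = x)
    (hfix : ∀ x, x ∈ (algebraMap E₀ E).range ↔ σ x = x) {x : E} (hx : σ x ≠ x) :
    algebraMap E₀ E (Algebra.norm E₀ x) = x * σ x := by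
  have : FiniteDimensional E₀ E := FiniteDimensional.of_finrank_pos (by omega)
  let B := Module.finBasisOfFinrankEq E₀ E hE
  let A := Algebra.leftMulMatrix B x
  have h1 : x ^ 2 - algebraMap E₀ E A.trace * x + algebraMap E₀ E A.det = 0 := by
    have h2 := Matrix.aeval_self_charpoly A
    rw [Matrix.charpoly_fin_two, Polynomial.aeval_algHom_apply] at h2
    have h3 := (injective_iff_map_eq_zero _).mp (Algebra.leftMulMatrix_injective B) _ h2
    simpa using h3
  rw [Algebra.norm_eq_matrix_det B]
  obtain ⟨s, hs⟩ := (hfix (x + σ x)).mpr (by rw [map_add, hσ, add_comm])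
  obtain ⟨p, hp⟩ := (hfix (x * σ x)).mpr (by rw [map_mul, hσ, mul_comm])
  -- The characteristic polynomial of `x` and `(T - x)(T - σ x)` are monic quadratics over `E₀` with
  -- root `x`; their difference is linear and must vanish, as `x` is not in `E₀`.
  have h4 : algebraMap E₀ E (s - A.trace) * x = algebraMap E₀ E (p - A.det) := by
    rw [map_sub, map_sub, hs, hp]
    linear_combination h1
  have h5 : s - A.trace = 0 := by
    by_contra h0
    refine hx ((hfix x).mp ⟨(p - A.det) / (s - A.trace), ?_⟩)
    rw [map_div₀, ← h4, mul_div_cancel_left₀]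
    exact (map_ne_zero _).mpr h0
  rw [h5, map_zero, zero_mul, eq_comm, map_eq_zero, sub_eq_zero] at h4
  rw [← hp, h4]

end QuadraticNorm

/-! ### The form induced on `W` by a trace pairing that is symmetric modulo `𝔭_F` -/

section TraceForm

variable {F V : Type*} [Field F] [ValuativeRel F] [AddCommGroup V] [Module F V]
  {c : F →+* F}

/-- `tr(u (X c₀ - c₀ X) ᵅY)`. -/
def traceVal (h : V →ₗ[F] V →ₛₗ[c] F) (u c₀ X Y : Module.End F V) : F :=
  LinearMap.trace F V (u * (X * c₀ - c₀ * X) * alpha h Y)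

/-- The properties of `traceVal` that make it induce a symmetric bilinear form on `W`. -/
structure IsSymmIntegral (L : LatticeChain F V) (K K' : Subalgebra F (Module.End F V)) (r : ℤ)
    (h : V →ₗ[F] V →ₛₗ[c] F) (u c₀ : Module.End F V) : Prop where
  val_le : ∀ X ∈ wNum L K' r, ∀ Y ∈ wNum L K' r, valuation F (traceVal h u c₀ X Y) ≤ 1
  val_lt : ∀ X ∈ wDen L K K' r, ∀ Y ∈ wNum L K' r, valuation F (traceVal h u c₀ X Y) < 1
  symm : ∀ X ∈ wNum L K' r, ∀ Y ∈ wNum L K' r,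
    valuation F (traceVal h u c₀ X Y - traceVal h u c₀ Y X) < 1

omit [ValuativeRel F] in
theorem traceVal_add_left (h : V →ₗ[F] V →ₛₗ[c] F) (u c₀ X X' Y : Module.End F V) :
    traceVal h u c₀ (X + X') Y = traceVal h u c₀ X Y + traceVal h u c₀ X' Y := by
  unfold traceVal
  rw [← map_add]
  congr 1
  noncomm_ring

omit [ValuativeRel F] in
theorem traceVal_sub_left (h : V →ₗ[F] V →ₛₗ[c] F) (u c₀ X X' Y : Module.End F V) :
    traceVal h u c₀ (X - X') Y = traceVal h u c₀ X Y - traceVal h u c₀ X' Y := by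
  unfold traceVal
  rw [← map_sub]
  congr 1
  noncomm_ring

omit [ValuativeRel F] in
theorem traceVal_smul_left (h : V →ₗ[F] V →ₛₗ[c] F) (u c₀ : Module.End F V) (a : F)
    (X Y : Module.End F V) : traceVal h u c₀ (a • X) Y = a * traceVal h u c₀ X Y := by
  have h1 : u * (a • X * c₀ - c₀ * a • X) * alpha h Y =
      a • (u * (X * c₀ - c₀ * X) * alpha h Y) := by
    simp only [smul_mul_assoc, mul_smul_comm, ← smul_sub]
  rw [traceVal, h1, map_smul, smul_eq_mul, traceVal]

variable {L : LatticeChain F V} {K K' : Subalgebra F (Module.End F V)} {r : ℤ}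
    {h : V →ₗ[F] V →ₛₗ[c] F} {u c₀ : Module.End F V}

theorem W.mk_surjective : Function.Surjective (W.mk L K K' r) :=
  Submodule.mkQ_surjective _

theorem W.mk_eq_zero_iff (X : wNum L K' r) :
    W.mk L K K' r X = 0 ↔ (X : Module.End F V) ∈ wDen L K K' r :=
  Submodule.Quotient.mk_eq_zero _

theorem W.residue_smul (a : 𝒪[F]) (x : W L K K' r) :
    IsLocalRing.residue 𝒪[F] a • x = a • x :=
  Module.IsTorsionBySet.mk_smul (W.isTorsionBySet L K K' r) a x

namespace IsSymmIntegral

variable (H : IsSymmIntegral L K K' r h u c₀)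
include H

/-- The reduction of `traceVal`. -/
def red (X Y : wNum L K' r) : 𝓀[F] :=
  IsLocalRing.residue 𝒪[F] ⟨traceVal h u c₀ X Y, H.val_le X X.2 Y Y.2⟩

theorem red_symm (X Y : wNum L K' r) : H.red X Y = H.red Y X :=
  (residue_eq_iff _ _).mpr (H.symm X X.2 Y Y.2)

theorem red_add_left (X X' Y : wNum L K' r) : H.red (X + X') Y = H.red X Y + H.red X' Y := by
  unfold red
  rw [← map_add]
  congr 1
  exact Subtype.ext (traceVal_add_left h u c₀ X X' Y)

theorem red_smul_left (a : 𝒪[F]) (X Y : wNum L K' r) :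
    H.red (a • X) Y = IsLocalRing.residue 𝒪[F] a * H.red X Y := by
  unfold red
  rw [← map_mul]
  congr 1
  exact Subtype.ext (traceVal_smul_left h u c₀ a X Y)

theorem red_congr_left {X X' : wNum L K' r} (hX : W.mk L K K' r X = W.mk L K K' r X')
    (Y : wNum L K' r) : H.red X Y = H.red X' Y := by
  rw [← sub_eq_zero, ← map_sub, W.mk_eq_zero_iff] at hX
  refine (residue_eq_iff _ _).mpr ?_
  change valuation F (traceVal h u c₀ X Y - traceVal h u c₀ X' Y) < 1
  rw [← traceVal_sub_left]
  exact H.val_lt _ hX Y Y.2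

/-- Symmetry carries independence of the representative from the left variable to the right one. -/
theorem red_congr {X X' Y Y' : wNum L K' r} (hX : W.mk L K K' r X = W.mk L K K' r X')
    (hY : W.mk L K K' r Y = W.mk L K K' r Y') : H.red X Y = H.red X' Y' := by
  rw [H.red_congr_left hX, H.red_symm, H.red_congr_left hY, H.red_symm]

/-- The form induced by `traceVal`. -/
def form : LinearMap.BilinForm 𝓀[F] (W L K K' r) :=
  let σ := Function.surjInv (W.mk_surjective (L := L) (K := K) (K' := K') (r := r))
  have hσ : ∀ x, W.mk L K K' r (σ x) = x := Function.surjInv_eq _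
  have hadd : ∀ x x' y, H.red (σ (x + x')) y = H.red (σ x) y + H.red (σ x') y := by
    intro x x' y
    rw [← H.red_add_left]
    exact H.red_congr_left (by rw [map_add, hσ, hσ, hσ]) y
  have hsmul : ∀ (a : 𝓀[F]) x y, H.red (σ (a • x)) y = a * H.red (σ x) y := by
    intro a x y
    obtain ⟨a, rfl⟩ := IsLocalRing.residue_surjective a
    rw [← H.red_smul_left]
    exact H.red_congr_left (by rw [map_smul, hσ, hσ, W.residue_smul]) y
  LinearMap.mk₂ 𝓀[F] (fun x y => H.red (σ x) (σ y))
    (fun x x' y => hadd x x' (σ y)) (fun a x y => hsmul a x (σ y))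
    (fun x y y' => by
      rw [H.red_symm, hadd, H.red_symm, H.red_symm (σ y')])
    (fun a x y => by
      rw [H.red_symm, hsmul, H.red_symm]
      rfl)

theorem form_mk (X Y : wNum L K' r) :
    H.form (W.mk L K K' r X) (W.mk L K K' r Y) = H.red X Y :=
  H.red_congr (Function.surjInv_eq _ _) (Function.surjInv_eq _ _)

theorem eq_red {D : LinearMap.BilinForm 𝓀[F] (W L K K' r)}
    (hD : IsTraceForm L K K' r h u c₀ D) (X Y : wNum L K' r) :
    D (W.mk L K K' r X) (W.mk L K K' r Y) = H.red X Y := by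
  obtain ⟨t, ht, hDt⟩ := hD X Y
  rw [hDt]
  unfold red
  congr 1
  exact Subtype.ext ht

theorem existsUnique_isTraceForm :
    ∃! D : LinearMap.BilinForm 𝓀[F] (W L K K' r), IsTraceForm L K K' r h u c₀ D := by
  refine ⟨H.form, fun X Y => ⟨_, rfl, H.form_mk X Y⟩, fun D hD => ?_⟩
  ext x y
  obtain ⟨X, rfl⟩ := W.mk_surjective x
  obtain ⟨Y, rfl⟩ := W.mk_surjective y
  rw [H.eq_red hD, H.form_mk]

theorem isTraceForm_symm {D : LinearMap.BilinForm 𝓀[F] (W L K K' r)}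
    (hD : IsTraceForm L K K' r h u c₀ D) (x y : W L K K' r) : D x y = D y x := by
  obtain ⟨X, rfl⟩ := W.mk_surjective x
  obtain ⟨Y, rfl⟩ := W.mk_surjective y
  rw [H.eq_red hD, H.eq_red hD, H.red_symm]

theorem isTraceForm_separating {D : LinearMap.BilinForm 𝓀[F] (W L K K' r)}
    (hD : IsTraceForm L K K' r h u c₀ D)
    (hsep : ∀ X ∈ wNum L K' r, (∀ Y ∈ wNum L K' r, valuation F (traceVal h u c₀ X Y) < 1) →
      X ∈ wDen L K K' r) (x : W L K K' r) (hx : ∀ y, D x y = 0) : x = 0 := by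
  obtain ⟨X, rfl⟩ := W.mk_surjective x
  rw [W.mk_eq_zero_iff]
  refine hsep X X.2 fun Y hY => ?_
  have h1 := hx (W.mk L K K' r ⟨Y, hY⟩)
  rw [H.eq_red hD] at h1
  rw [red, IsLocalRing.residue_eq_zero_iff, mem_maximalIdeal_iff] at h1
  exact h1

end IsSymmIntegral

end TraceForm

/-! ### Orthogonal sums of symmetric forms -/

section OrthogonalSum

variable {k : Type*} [Field k] {m : ℕ} {M : Fin m → Type*} [∀ j, AddCommGroup (M j)]
    [∀ j, Module k (M j)] (D : ∀ j, LinearMap.BilinForm k (M j))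

theorem orthogonalSum_apply (x y : ⨁ j, M j) :
    orthogonalSum D x y = ∑ j, D j (x j) (y j) := by
  simp [orthogonalSum, LinearMap.sum_apply, DirectSum.component]
  rfl

variable {D} (hD : ∀ j x y, D j x y = D j y x)
include hD

theorem orthogonalSum_comm (x y : ⨁ j, M j) : orthogonalSum D x y = orthogonalSum D y x := by
  rw [orthogonalSum_apply, orthogonalSum_apply]
  exact Finset.sum_congr rfl fun j _ => hD j _ _

variable (hsep : ∀ j x, (∀ y, D j x y = 0) → x = 0)
include hsep

omit hD in
theorem eq_zero_of_orthogonalSum_eq_zero (x : ⨁ j, M j)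
    (hx : ∀ y, orthogonalSum D x y = 0) : x = 0 := by
  refine DFinsupp.ext fun j => hsep j _ fun y => ?_
  have h1 := hx (DirectSum.of M j y)
  rw [orthogonalSum_apply, Finset.sum_eq_single j] at h1
  · rwa [DirectSum.of_eq_same] at h1
  · intro i _ hij
    rw [DirectSum.of_eq_of_ne _ _ _ hij, map_zero]
  · simp

/-- By symmetry the polar form is twice the bilinear form, so both have the same radical when 2 is
invertible. -/
theorem orthogonalSum_nondegenerate (h2 : (2 : k) ≠ 0) :
    (orthogonalSum D).IsSymm ∧ (orthogonalSum D).Nondegenerate ∧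
      (orthogonalSum D).toQuadraticMap.polarBilin.Nondegenerate := by
  have hpol : ∀ x y, (orthogonalSum D).toQuadraticMap.polarBilin x y =
      2 * orthogonalSum D x y := by
    intro x y
    rw [QuadraticMap.polarBilin_apply_apply, LinearMap.BilinMap.polar_toQuadraticMap,
      orthogonalSum_comm hD y x, two_mul]
  have hsep' := eq_zero_of_orthogonalSum_eq_zero hsep
  refine ⟨⟨fun x y => ?_⟩, ⟨fun x hx => hsep' x hx, fun y hy => hsep' y fun x => ?_⟩,
    ⟨fun x hx => hsep' x fun y => ?_, fun y hy => hsep' y fun x => ?_⟩⟩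
  · simpa using orthogonalSum_comm hD x y
  · rw [orthogonalSum_comm hD]
    exact hy x
  · have := hx y
    rw [hpol] at this
    exact (mul_eq_zero.mp this).resolve_left h2
  · have := hy x
    rw [hpol, orthogonalSum_comm hD] at this
    exact (mul_eq_zero.mp this).resolve_left h2

end OrthogonalSum

/-! ### Centralizers of the fields `F[γ]` -/

section Centralizer

variable {F E V : Type*} [Field F] [Field E] [Algebra F E] [AddCommGroup V] [Module F V]
  [Module E V] [IsScalarTower F E V]

theorem fieldOf_eq_map (γ : E) :
    fieldOf F V γ = (Algebra.adjoin F {γ}).map (emb F V) := by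
  rw [fieldOf, AlgHom.map_adjoin, Set.image_singleton]

theorem mem_centralizer_fieldOf_iff {γ : E} {X : Module.End F V} :
    X ∈ Subalgebra.centralizer F (fieldOf F V γ : Set (Module.End F V)) ↔
      ∀ x ∈ Algebra.adjoin F {γ}, emb F V x * X = X * emb F V x := by
  rw [Subalgebra.mem_centralizer_iff, fieldOf_eq_map]
  constructor
  · intro hX x hx
    exact hX _ ⟨x, hx, rfl⟩
  · rintro hX _ ⟨x, hx, rfl⟩
    exact hX x hx

theorem mem_centralizer_fieldOf {γ : E} {X : Module.End F V}
    (hX : emb F V γ * X = X * emb F V γ) :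
    X ∈ Subalgebra.centralizer F (fieldOf F V γ : Set (Module.End F V)) := by
  rw [mem_centralizer_fieldOf_iff]
  intro x hx
  induction hx using Algebra.adjoin_induction with
  | mem x hx =>
    rw [Set.mem_singleton_iff] at hx
    rwa [hx]
  | algebraMap r => rw [AlgHom.commutes, Algebra.commutes]
  | add x y _ _ hx hy => rw [map_add, add_mul, mul_add, hx, hy]
  | mul x y _ _ hx hy => rw [map_mul, mul_assoc, hy, ← mul_assoc, hx, mul_assoc]

theorem emb_mul_comm (x y : E) : emb F V x * emb F V y = emb F V y * emb F V x := by
  rw [← map_mul, ← map_mul, mul_comm]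

end Centralizer

/-- For even `r` the two exponents that define `W` agree and `W` vanishes; for odd `r` they differ
by one. -/
theorem floor_ceil_half (r : ℤ) :
    (∃ k, r = 2 * k ∧ -1 + ceilPlus ((r : ℚ) / 2) = k ∧ ⌈(r : ℚ) / 2⌉ = k) ∨
      ∃ k, r = 2 * k + 1 ∧ -1 + ceilPlus ((r : ℚ) / 2) = k ∧ ⌈(r : ℚ) / 2⌉ = k + 1 := by
  unfold ceilPlus
  rcases Int.even_or_odd' r with ⟨k, rfl | rfl⟩
  · left
    refine ⟨k, rfl, ?_, ?_⟩
    · have : ⌊((2 * k : ℤ) : ℚ) / 2⌋ = k := by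
        rw [Int.floor_eq_iff]
        push_cast
        constructor <;> linarith
      omega
    · rw [Int.ceil_eq_iff]
      push_cast
      constructor <;> linarith
  · right
    refine ⟨k, rfl, ?_, ?_⟩
    · have : ⌊((2 * k + 1 : ℤ) : ℚ) / 2⌋ = k := by
        rw [Int.floor_eq_iff]
        push_cast
        constructor <;> linarith
      omega
    · rw [Int.ceil_eq_iff]
      push_cast
      constructor <;> linarith

/-! ### Symmetry and non-degeneracy of a single form `D_j` -/

section Step

variable {F E V : Type*} [Field F] [ValuativeRel F] [TopologicalSpace F]
  [IsNonarchimedeanLocalField F] [Field E] [ValuativeRel E] [TopologicalSpace E]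
  [IsNonarchimedeanLocalField E] [Algebra F E] [ValuativeExtension F E]
  [AddCommGroup V] [Module F V] [FiniteDimensional F V] [Module E V] [IsScalarTower F E V]
  {c : F →+* F} {h : V →ₗ[F] V →ₛₗ[c] F} (hc : Function.Surjective c) (hh : h.SeparatingRight)
  {ε : F} (hε : ε = 1 ∨ ε = -1) (hherm : ∀ v w, h w v = ε * c (h v w)) (hcc : ∀ a, c (c a) = a)

include hc hh hε hherm hcc in
omit [ValuativeRel F] [TopologicalSpace F] [IsNonarchimedeanLocalField F] in
theorem alpha_alpha (X : Module.End F V) : alpha h (alpha h X) = X := by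
  unfold alpha
  rw [conjAdjoint_neg hc hh, neg_neg, conjAdjoint_conjAdjoint hc hh hε hherm hcc]

include hc hh in
omit [ValuativeRel F] [TopologicalSpace F] [IsNonarchimedeanLocalField F] in
theorem alpha_sub (X Y : Module.End F V) : alpha h (X - Y) = alpha h X - alpha h Y := by
  rw [alpha, conjAdjoint_sub hc hh, alpha, alpha]
  abel

include hc hh in
omit [ValuativeRel F] [TopologicalSpace F] [IsNonarchimedeanLocalField F] in
theorem alpha_commute {X Y : Module.End F V} (hY : alpha h Y = Y) (hXY : Y * X = X * Y) :
    Y * alpha h X = alpha h X * Y := by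
  have hY' : conjAdjoint h Y = -Y := by rw [← hY, alpha, neg_neg, ← alpha, hY]
  have h1 := congrArg (conjAdjoint h) hXY
  rw [conjAdjoint_mul hc hh, conjAdjoint_mul hc hh, hY', mul_neg, neg_mul, neg_inj] at h1
  rw [alpha, mul_neg, neg_mul, h1]

include hc hh hε hherm hcc in
omit [ValuativeRel F] [TopologicalSpace F] [IsNonarchimedeanLocalField F] in
-- The adjoint conjugates the trace and reverses products. Skewness of `u` and `c₀` controls the
-- signs; cyclicity of the trace and `u c₀ = c₀ u` then restore the original shape with `X` and `Y`
-- exchanged.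
theorem conj_traceVal {u c₀ : Module.End F V} (hu : conjAdjoint h u = -u) (hc₀ : alpha h c₀ = c₀)
    (huc : u * c₀ = c₀ * u) (X Y : Module.End F V) :
    c (traceVal h u c₀ X Y) = traceVal h u c₀ Y X := by
  have hc₀' : conjAdjoint h c₀ = -c₀ := by rw [← hc₀, alpha, neg_neg, ← alpha, hc₀]
  have hY : conjAdjoint h (alpha h Y) = -Y := by
    rw [alpha, conjAdjoint_neg hc hh, conjAdjoint_conjAdjoint hc hh hε hherm hcc]
  unfold traceVal
  rw [← trace_conjAdjoint hc hh hε hherm, conjAdjoint_mul hc hh, conjAdjoint_mul hc hh,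
    conjAdjoint_sub hc hh, conjAdjoint_mul hc hh, conjAdjoint_mul hc hh, hu, hc₀', hY]
  have h1 : -Y * ((-c₀ * conjAdjoint h X - conjAdjoint h X * -c₀) * -u) =
      Y * c₀ * alpha h X * u - Y * alpha h X * c₀ * u := by
    unfold alpha
    noncomm_ring
  have h2 : u * (Y * c₀ - c₀ * Y) * alpha h X =
      u * (Y * c₀ * alpha h X) - (c₀ * u) * (Y * alpha h X) := by
    rw [← huc]
    noncomm_ring
  rw [h1, h2, map_sub, map_sub, LinearMap.trace_mul_comm F _ u,
    LinearMap.trace_mul_comm F (c₀ * u), mul_assoc (Y * alpha h X)]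

variable {L : LatticeChain F V} {ϖ : 𝒪[E]} {w : V} (hw : IsGenerator L ϖ w)
  (hϖ : Irreducible ϖ)
  (hself : ∃ m : ℤ, ∀ k v, v ∈ L.toFun (m - k) ↔ ∀ w ∈ L.toFun k, valuation F (h v w) < 1)
  (hcval : ∀ a, valuation F a ≤ 1 → valuation F (c a - a) < 1)
  {u : E} (hu : valuation E u = valuation E (ϖ : E))
  (hubar : conjAdjoint h (emb F V u) = -emb F V u)
  {γ γ' : E} (hγ : alpha h (emb F V γ) = emb F V γ) (hγ' : alpha h (emb F V γ') = emb F V γ')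
  (htower : Algebra.adjoin F {γ'} ≤ Algebra.adjoin F {γ}) {r : ℤ}
  (hequiv : emb F V (γ - γ') ∈ L.frakP (-r))

include hc hh hε hherm hself hcval in
omit [TopologicalSpace F] [IsNonarchimedeanLocalField F] in
theorem alpha_mem_frakP {k : ℤ} {X : Module.End F V} (hX : X ∈ L.frakP k) :
    alpha h X ∈ L.frakP k := by
  refine neg_mem (conjAdjoint_mem_frakP hc hh hε hherm L hself (fun a ha => ?_) hX)
  have h1 : c a = (c a - a) + a := by ring
  rw [h1]
  exact Valuation.map_add_lt _ (hcval a ha.le) ha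

include hc hh hε hherm hcc hw hϖ hself hcval hu hubar hγ hγ' htower hequiv in
theorem isSymmIntegral : IsSymmIntegral L (fieldOf F V γ) (fieldOf F V γ') r h
    (emb F V u) (emb F V (γ - γ')) := by
  have hu1 : emb F V u ∈ L.frakP 1 := hw.emb_mem_frakP hϖ (by rw [hu, zpow_one])
  -- Degree count: `u` contributes 1, `c₀` contributes `-r`, and `α` preserves the filtration. With
  -- `a = b = ⌊r/2⌋` the total is 0 or 1; with `a = ⌈r/2⌉` it is at least 1.
  have hval : ∀ (a b m : ℤ), m ≤ 1 + (a - r) + b → ∀ X ∈ L.frakP a, ∀ Y ∈ L.frakP b,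
      emb F V u * (X * emb F V (γ - γ') - emb F V (γ - γ') * X) * alpha h Y ∈ L.frakP m := by
    intro a b m hm X hX Y hY
    refine L.mul_mem_frakP (k := 1 + (a - r)) (l := b) hm (L.mul_mem_frakP le_rfl hu1
      (sub_mem ?_ ?_)) (alpha_mem_frakP hc hh hε hherm hself hcval hY)
    · exact L.mul_mem_frakP (by omega) hX hequiv
    · exact L.mul_mem_frakP (by omega) hequiv hX
  have hle : ∀ X ∈ wNum L (fieldOf F V γ') r, ∀ Y ∈ wNum L (fieldOf F V γ') r,
      valuation F (traceVal h (emb F V u) (emb F V (γ - γ')) X Y) ≤ 1 := by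
    intro X hX Y hY
    refine LatticeChain.val_trace_le_one (hval _ _ 0 ?_ X hX.1 Y hY.1)
    rcases floor_ceil_half r with ⟨k, h1, h2, h3⟩ | ⟨k, h1, h2, h3⟩ <;> omega
  have hc₀ : alpha h (emb F V (γ - γ')) = emb F V (γ - γ') := by
    rw [map_sub, alpha_sub hc hh, hγ, hγ']
  refine ⟨hle, ?_, fun X hX Y hY => ?_⟩
  · intro X hX Y hY
    obtain ⟨X₁, hX₁, X₂, hX₂, rfl⟩ := Submodule.mem_sup.mp hX
    rw [traceVal_add_left]
    refine Valuation.map_add_lt _ ?_ ?_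
    · have h1 := mem_centralizer_fieldOf_iff.mp hX₁.2 (γ - γ')
        (sub_mem (Algebra.self_mem_adjoin_singleton F γ)
          (htower (Algebra.self_mem_adjoin_singleton F γ')))
      rw [traceVal, h1, sub_self, mul_zero, zero_mul, map_zero, map_zero]
      exact zero_lt_one
    · refine hw.val_trace_lt_one hϖ (hval _ _ 1 ?_ X₂ hX₂.1 Y hY.1)
      rcases floor_ceil_half r with ⟨k, h1, h2, h3⟩ | ⟨k, h1, h2, h3⟩ <;> omega
  · rw [← conj_traceVal hc hh hε hherm hcc hubar hc₀ (emb_mul_comm _ _) X Y, ← Valuation.map_neg,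
      neg_sub]
    exact hcval _ (hle X hX Y hY)

include hc hh hε hherm hcc hw hϖ hself hcval hu hγ' htower hequiv in
-- Duality turns vanishing of the pairing into a bound on the commutator of `X` with `c₀`; the
-- critical exponent turns that bound into a decomposition of `X`.
theorem mem_wDen_of_forall_val_lt_one [FiniteDimensional F E] {b : E} (hb : valuation E b ≤ 1)
    (hb' : valuation F (Algebra.trace F E b) = 1)
    (hcrit : γ ∈ (algebraMap F E).range ∨ L.IsCriticalExponent ⊥ (emb F V γ) (-r))
    {X : Module.End F V} (hX : X ∈ wNum L (fieldOf F V γ') r)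
    (hXY : ∀ Y ∈ wNum L (fieldOf F V γ') r,
      valuation F (traceVal h (emb F V u) (emb F V (γ - γ')) X Y) < 1) :
    X ∈ wDen L (fieldOf F V γ) (fieldOf F V γ') r := by
  have hϖ0 := irreducible_coe_ne_zero hϖ
  have hu0 : u ≠ 0 := by
    rintro rfl
    rw [map_zero] at hu
    exact val_irreducible_ne_zero hϖ hu.symm
  unfold wDen
  unfold wNum at hX hXY
  rcases floor_ceil_half r with ⟨k, h1, h2, h3⟩ | ⟨k, h1, h2, h3⟩
  · rw [h2] at hX
    rw [h3]
    exact Submodule.mem_sup_right hX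
  rw [h2] at hX hXY
  rw [h2, h3]
  -- If `γ ∈ F`, everything commutes with `γ`, and `X` lies in the first summand of the denominator.
  rcases hcrit with ⟨a, rfl⟩ | hcrit
  · refine Submodule.mem_sup_left ⟨hX.1, mem_centralizer_fieldOf ?_⟩
    rw [AlgHom.commutes, Algebra.commutes]
  have hXc := mem_centralizer_fieldOf_iff.mp hX.2
  have hXγ' := hXc γ' (Algebra.self_mem_adjoin_singleton F γ')
  set c₀ := emb F V (γ - γ') with hc₀
  -- `F[γ']` is a field because `γ'` is algebraic, so duality applies on its centralizer.
  have hE' : ∀ x ∈ IntermediateField.adjoin F {γ'}, x ∈ Algebra.adjoin F {γ'} := by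
    intro x hx
    rwa [← IntermediateField.adjoin_simple_toSubalgebra_of_isAlgebraic
      (Algebra.IsAlgebraic.isAlgebraic γ'), IntermediateField.mem_toSubalgebra]
  have hZ : emb F V u * (X * c₀ - c₀ * X) ∈ L.frakP (1 - k) := by
    refine hw.mem_frakP_of_val_trace_lt_one hϖ hb hb' (IntermediateField.adjoin F {γ'}) ?_ ?_
    · intro x hx
      have h4 := hXc x (hE' x hx)
      have h5 : emb F V x * emb F V u = emb F V u * emb F V x := emb_mul_comm _ _
      have h6 : emb F V x * c₀ = c₀ * emb F V x := emb_mul_comm _ _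
      have h7 : emb F V x * (X * c₀ - c₀ * X) = (X * c₀ - c₀ * X) * emb F V x :=
        (Commute.mul_right h4 h6).sub_right (Commute.mul_right h6 h4)
      rw [← mul_assoc, h5, mul_assoc, h7, mul_assoc]
    · intro Y hY hYc
      -- `α` is involutive and preserves the numerator, so testing against `ᵅY` removes the `α` from
      -- the form.
      have h4 := hXY (alpha h Y) ⟨alpha_mem_frakP hc hh hε hherm hself hcval hY,
        mem_centralizer_fieldOf (alpha_commute hc hh hγ'
          (hYc γ' (IntermediateField.mem_adjoin_simple_self F γ')))⟩
      rwa [traceVal, alpha_alpha hc hh hε hherm hcc] at h4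
  have hcomm : X * c₀ - c₀ * X ∈ L.frakP (-k) := by
    have h4 : X * c₀ - c₀ * X = emb F V u⁻¹ * (emb F V u * (X * c₀ - c₀ * X)) := by
      rw [← mul_assoc, ← map_mul, inv_mul_cancel₀ hu0, map_one, one_mul]
    rw [h4]
    refine L.mul_mem_frakP (k := -1) (by omega) (hw.emb_mem_frakP hϖ ?_) hZ
    rw [map_inv₀, hu, zpow_neg_one]
  have hϖk : ∀ m : ℤ, emb F V ((ϖ : E) ^ m) ∈ L.frakP m := fun m =>
    hw.emb_mem_frakP hϖ (by rw [map_zpow₀])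
  have hcancel : emb F V ((ϖ : E) ^ k) * emb F V ((ϖ : E) ^ (-k)) = 1 := by
    rw [← map_mul, ← zpow_add₀ hϖ0, add_neg_cancel, zpow_zero, map_one]
  set x := emb F V ((ϖ : E) ^ (-k)) * X with hx
  have hx0 : x ∈ L.frakP 0 := L.mul_mem_frakP (by omega) (hϖk (-k)) hX.1
  have hxX : emb F V ((ϖ : E) ^ k) * x = X := by rw [hx, ← mul_assoc, hcancel, one_mul]
  -- `X` commutes with `γ'`, so `γ` and `c₀` have the same commutator with it; moreover `-k - k = 1
  -- - r`.
  have hcx : emb F V γ * x - x * emb F V γ ∈ L.frakP (1 - r) := by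
    have h4 : emb F V γ * x - x * emb F V γ =
        -(emb F V ((ϖ : E) ^ (-k)) * (X * c₀ - c₀ * X)) := by
      have h5 : emb F V γ = c₀ + emb F V γ' := by rw [hc₀, map_sub, sub_add_cancel]
      have h6 : emb F V γ * emb F V ((ϖ : E) ^ (-k)) = emb F V ((ϖ : E) ^ (-k)) * emb F V γ :=
        emb_mul_comm _ _
      rw [hx, ← mul_assoc, h6, mul_assoc, mul_assoc, ← mul_sub, h5, add_mul, mul_add, hXγ',
        ← mul_neg]
      congr 1
      noncomm_ring
    rw [h4]
    exact neg_mem (L.mul_mem_frakP (by omega) (hϖk (-k)) hcomm)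
  -- The greatest element of the critical set is `-r`, just below `1 - r`.
  have hnot : 1 - r ∉ L.critSet ⊥ (emb F V γ) := fun hmem => by
    have := hcrit.2 hmem
    omega
  have hxmem : x ∈ L.frakPCent (⊥ ⊔ Algebra.adjoin F {emb F V γ}) 0 ⊔ L.frakPCent ⊥ 1 := by
    by_contra hxn
    refine hnot ⟨x, ⟨hx0, ?_⟩, hcx, hxn⟩
    change x ∈ Subalgebra.centralizer F ((⊥ : Subalgebra F (Module.End F V)) : Set _)
    rw [Subalgebra.mem_centralizer_iff]
    intro g hg
    obtain ⟨a, rfl⟩ := Algebra.mem_bot.mp hg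
    exact Algebra.commutes a x
  obtain ⟨y, hy, z, hz, hyz⟩ := Submodule.mem_sup.mp hxmem
  have hyγ : y ∈ Subalgebra.centralizer F (fieldOf F V γ : Set (Module.End F V)) := by
    have h4 := hy.2
    rwa [bot_sup_eq] at h4
  have hyc := mem_centralizer_fieldOf_iff.mp hyγ
  have hy' : emb F V ((ϖ : E) ^ k) * y ∈ L.frakPCent (fieldOf F V γ) k := by
    refine ⟨L.mul_mem_frakP (by omega) (hϖk k) hy.1, mem_centralizer_fieldOf ?_⟩
    exact Commute.mul_right (emb_mul_comm _ _) (hyc γ (Algebra.self_mem_adjoin_singleton F γ))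
  have hXyz : X = emb F V ((ϖ : E) ^ k) * y + emb F V ((ϖ : E) ^ k) * z := by
    rw [← mul_add, hyz, hxX]
  rw [hXyz]
  refine Submodule.add_mem_sup hy' ⟨L.mul_mem_frakP (by omega) (hϖk k) hz.1,
    mem_centralizer_fieldOf ?_⟩
  -- The decomposition takes place in all of `End_F(V)`; `ϖ^k z` commutes with `γ'` because `X` and
  -- `ϖ^k y` do.
  have hz' : emb F V ((ϖ : E) ^ k) * z = X - emb F V ((ϖ : E) ^ k) * y := by
    rw [hXyz, add_sub_cancel_left]
  rw [hz']
  exact Commute.sub_right hXγ' (Commute.mul_right (emb_mul_comm _ _)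
    (hyc γ' (htower (Algebra.self_mem_adjoin_singleton F γ'))))

end Step

/-! ### The involution induced on `E` by the adjoint -/

section Conjugation

theorem ringChar_residueField_not_dvd {K : Type*} [Field K] [ValuativeRel K] {N : ℕ}
    (hN : N.Coprime (ringChar 𝓀[K])) : ¬ ringChar 𝓀[K] ∣ N := by
  intro h
  have h1 := Nat.dvd_gcd h dvd_rfl
  rw [hN.gcd_eq_one, Nat.dvd_one] at h1
  exact CharP.ringChar_ne_one h1

variable {F E V : Type*} [Field F] [Field E] [Algebra F E]
  [AddCommGroup V] [Module F V] [FiniteDimensional F V] [Module E V] [IsScalarTower F E V]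
  [Nontrivial V]
  {c : F →+* F} {h : V →ₗ[F] V →ₛₗ[c] F} (hc : Function.Surjective c) (hh : h.SeparatingRight)
  {ε : F} (hε : ε = 1 ∨ ε = -1) (hherm : ∀ v w, h w v = ε * c (h v w))

omit [FiniteDimensional F V] in
include hh hε hherm in
-- The Hermitian symmetry applied twice, at a value `a` of the non-zero form `h`.
theorem involutive_of_hermitian (a : F) : c (c a) = a := by
  obtain ⟨w, hw⟩ := exists_ne (0 : V)
  obtain ⟨v, hv⟩ : ∃ v, h v w ≠ 0 := by
    by_contra! hcon
    exact hw (hh w hcon)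
  have h1 : h ((a / h v w) • v) w = a := by simp [hv]
  have h2 := hherm w ((a / h v w) • v)
  rw [hherm ((a / h v w) • v) w, h1, map_mul] at h2
  rcases hε with rfl | rfl
  · simpa using h2.symm
  · simpa using h2.symm

omit [FiniteDimensional F V] in
theorem emb_injective : Function.Injective (emb F V : E →ₐ[F] Module.End F V) := by
  intro x y hxy
  obtain ⟨w, hw⟩ := exists_ne (0 : V)
  exact smul_left_injective E hw (LinearMap.congr_fun hxy w)

include hc hh hε hherm in
/-- If `E = F[β]` with `β` skew, then the adjoint preserves `E`. -/
theorem exists_conj_emb {β : E} (hβ : Algebra.adjoin F {β} = ⊤)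
    (hskew : alpha h (emb F V β) = emb F V β) :
    ∃ σ : E →+* E, (∀ x, conjAdjoint h (emb F V x) = emb F V (σ x)) ∧ ∀ x, σ (σ x) = x := by
  have hcc := involutive_of_hermitian hh hε hherm
  have hex : ∀ x : E, ∃ y : E, conjAdjoint h (emb F V x) = emb F V y := by
    intro x
    have hx : x ∈ Algebra.adjoin F {β} := hβ ▸ Algebra.mem_top
    induction hx using Algebra.adjoin_induction with
    | mem x hx =>
      rw [Set.mem_singleton_iff] at hx
      refine ⟨-β, ?_⟩
      rw [hx, map_neg, ← hskew, alpha, neg_neg, ← alpha, hskew]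
    | algebraMap r =>
      refine ⟨algebraMap F E (c r), ?_⟩
      rw [AlgHom.commutes, AlgHom.commutes, Algebra.algebraMap_eq_smul_one,
        conjAdjoint_smul hc hh hcc, conjAdjoint_one hc hh, Algebra.algebraMap_eq_smul_one]
    | add x y _ _ hx hy =>
      obtain ⟨x', hx'⟩ := hx
      obtain ⟨y', hy'⟩ := hy
      exact ⟨x' + y', by rw [map_add, conjAdjoint_add hc hh, hx', hy', map_add]⟩
    | mul x y _ _ hx hy =>
      obtain ⟨x', hx'⟩ := hx
      obtain ⟨y', hy'⟩ := hy
      exact ⟨y' * x', by rw [map_mul, conjAdjoint_mul hc hh, hx', hy', map_mul]⟩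
  choose σ hσ using hex
  have hinj := emb_injective (F := F) (E := E) (V := V)
  refine ⟨RingHom.mk' ⟨⟨σ, hinj ?_⟩, fun x y => hinj ?_⟩ fun x y => hinj ?_, hσ,
    fun x => hinj ?_⟩
  · rw [← hσ, map_one, conjAdjoint_one hc hh]
  · rw [← hσ, map_mul, conjAdjoint_mul hc hh, hσ, hσ, map_mul, emb_mul_comm]
  · change emb F V (σ (x + y)) = emb F V (σ x + σ y)
    rw [← hσ, map_add, conjAdjoint_add hc hh, hσ, hσ, map_add]
  · change emb F V (σ (σ x)) = _
    rw [← hσ, ← hσ, conjAdjoint_conjAdjoint hc hh hε hherm hcc]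

end Conjugation

/-! ### Action of the involution on `y` and `ϖ` -/

section QuadraticConj

variable {E₀ E : Type*} [Field E₀] [ValuativeRel E₀] [TopologicalSpace E₀]
  [IsNonarchimedeanLocalField E₀] [Field E] [ValuativeRel E] [TopologicalSpace E]
  [IsNonarchimedeanLocalField E] [Algebra E₀ E] [ValuativeExtension E₀ E]
  (hE : Module.finrank E₀ E = 2) (σ : E →+* E) (hσ : ∀ x, σ (σ x) = x)
  (hfix : ∀ x, x ∈ (algebraMap E₀ E).range ↔ σ x = x)

include hE hfix in
/-- Roots of unity of order prime to the residual characteristic are fixed by the conjugation of a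
ramified quadratic extension. -/
theorem conj_rootOfUnity (hram : ramIdx E₀ E = 2) {y : E} {N : ℕ} (hN0 : N ≠ 0) (hy : y ^ N = 1)
    (hN : valuation E (N : E) = 1) : σ y = y := by
  have hy0 : y ≠ 0 := by
    rintro rfl
    rw [zero_pow hN0] at hy
    exact zero_ne_one hy
  have hvy : valuation E y = 1 := by
    have h1 := congrArg (valuation E) hy
    rw [map_pow, map_one] at h1
    exact (pow_eq_one_iff.mp h1).resolve_right hN0
  let τ : E →ₐ[E₀] E := { σ with commutes' := fun a => (hfix _).mp ⟨a, rfl⟩ }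
  have h1 : valuation E (σ y - y) < 1 := val_algHom_sub_lt_one hE hram τ hvy.le
  -- The quotient is an `N`-th root of unity congruent to 1, because conjugation is trivial on the
  -- residue field.
  have h2 : σ y / y = 1 := by
    refine eq_one_of_pow_eq_one (N := N) ?_ hN ?_
    · rw [div_pow, ← map_pow, hy, map_one, div_one]
    · rw [div_sub_one hy0, map_div₀, hvy, div_one]
      exact h1
  rwa [div_eq_one_iff_eq hy0] at h2

omit [ValuativeRel E₀] [TopologicalSpace E₀] [IsNonarchimedeanLocalField E₀] [ValuativeRel E]
  [TopologicalSpace E] [IsNonarchimedeanLocalField E] [ValuativeExtension E₀ E] in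
include hE hσ hfix in
-- If `x` were fixed, its norm would be `x²` and `2x² = 0`. Otherwise the norm is `x σ(x)`, and
-- cancelling `x` gives the sign.
theorem conj_eq_neg_of_sq_eq_neg_norm (h2 : (2 : E) ≠ 0) {x : E} (hx0 : x ≠ 0)
    (hx : x ^ 2 = -algebraMap E₀ E (Algebra.norm E₀ x)) : σ x = -x := by
  by_cases hfx : σ x = x
  · obtain ⟨a, ha⟩ := (hfix x).mpr hfx
    rw [← ha, Algebra.norm_algebraMap, hE, map_pow, ha] at hx
    have h3 : 2 * x ^ 2 = 0 := by linear_combination hx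
    exact absurd h3 (mul_ne_zero h2 (pow_ne_zero 2 hx0))
  · rw [norm_eq_mul_conj hE σ hσ hfix hfx] at hx
    have h3 : x * (σ x + x) = 0 := by linear_combination hx
    exact eq_neg_of_add_eq_zero_left ((mul_eq_zero.mp h3).resolve_left hx0)

end QuadraticConj

theorem IsApproximation.crit_or {F E V : Type*} [Field F] [ValuativeRel F] [Field E] [Algebra F E]
    [AddCommGroup V] [Module F V] [Module E V] [IsScalarTower F E V] {L : LatticeChain F V}
    {n : ℤ} {β : E} {d : ℕ} {γ : Fin (d + 2) → E} {r : Fin (d + 1) → ℤ}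
    (H : IsApproximation L n β γ r) (j : Fin (d + 1)) :
    γ j.castSucc ∈ (algebraMap F E).range ∨
      L.IsCriticalExponent ⊥ (emb F V (γ j.castSucc)) (-(r j)) := by
  induction j using Fin.lastCases with
  | last =>
    rw [H.r_last]
    exact H.crit_last
  | cast j => exact Or.inr (H.crit j)

end StronglyRamified

end

/-! ### The theorem, assembled from the single forms `D_j` -/

theorem proposition4p7
    -- `F / F₀` is a ramified quadratic extension of local fields of odd residual characteristic,
    -- and `c` generates its Galois group
    {F₀ F E₀ E V : Type*}
    [Field F₀] [ValuativeRel F₀] [TopologicalSpace F₀] [IsNonarchimedeanLocalField F₀]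
    [Field F] [ValuativeRel F] [TopologicalSpace F] [IsNonarchimedeanLocalField F]
    [Algebra F₀ F] [ValuativeExtension F₀ F]
    (hodd : ringChar 𝓀[F₀] ≠ 2)
    (hF : Module.finrank F₀ F = 2) (hFram : StronglyRamified.ramIdx F₀ F = 2)
    (c : F ≃ₐ[F₀] F) (hc : c ≠ AlgEquiv.refl)
    -- `E` is a local field, finite and tamely ramified over `F`, and `V` is an `E`-vector space
    -- with `dim_F V = [E : F]`
    [Field E] [ValuativeRel E] [TopologicalSpace E] [IsNonarchimedeanLocalField E]
    [Algebra F E] [ValuativeExtension F E] [FiniteDimensional F E]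
    (htame : ¬ ringChar 𝓀[F] ∣ StronglyRamified.ramIdx F E)
    [AddCommGroup V] [Module F V] [FiniteDimensional F V] [Module E V] [IsScalarTower F E V]
    (hdim : Module.finrank F V = Module.finrank F E)
    -- `h` is a non-degenerate `ε`-Hermitian form on `V`
    (ε : F) (hε : ε = 1 ∨ ε = -1)
    (h : V →ₗ[F] V →ₛₗ[((c : F ≃+* F) : F →+* F)] F)
    (hherm : ∀ v w, h w v = ε * c (h v w)) (hnd : h.Nondegenerate)
    -- `[Λ, n, 0, β]` is a skew simple stratum with `E = F[β]`
    (L : StronglyRamified.LatticeChain F V)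
    (hself : ∃ m : ℤ, ∀ k v, v ∈ L.toFun (m - k) ↔ ∀ w ∈ L.toFun k, valuation F (h v w) < 1)
    (n : ℤ) (β : E) (hβ : Algebra.adjoin F {β} = ⊤)
    (hsimple : L.IsSimpleStratum ⊥ n 0 (StronglyRamified.emb F V β))
    -- the approximating skew strata `[Λ, n, r_j, γ_{j+1}]`
    (d : ℕ) (γ : Fin (d + 2) → E) (r : Fin (d + 1) → ℤ)
    (happrox : StronglyRamified.IsApproximation L n β γ r)
    (hskew : ∀ j, StronglyRamified.alpha h (StronglyRamified.emb F V (γ j)) =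
      StronglyRamified.emb F V (γ j))
    -- `E₀` is the subfield of `E` fixed by `-α`, and `E / E₀` is quadratic ramified
    [Field E₀] [ValuativeRel E₀] [TopologicalSpace E₀] [IsNonarchimedeanLocalField E₀]
    [Algebra E₀ E] [ValuativeExtension E₀ E]
    (hE₀ : ∀ x : E, x ∈ (algebraMap E₀ E).range ↔
      -StronglyRamified.alpha h (StronglyRamified.emb F V x) = StronglyRamified.emb F V x)
    (hE : Module.finrank E₀ E = 2) (hEram : StronglyRamified.ramIdx E₀ E = 2)
    -- `ϖ` is a uniformizer of `E` with `ϖ² = -N_{E/E₀}(ϖ)`, and `y ∈ μ_E`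
    (ϖ : 𝒪[E]) (hϖ : Irreducible ϖ)
    (hϖN : (ϖ : E) ^ 2 = -algebraMap E₀ E (Algebra.norm E₀ (ϖ : E)))
    (y : Eˣ) (hy : IsOfFinOrder y) (hyp : (orderOf y).Coprime (ringChar 𝓀[F])) :
    -- each `D_j` is well defined on `𝔚_{z,j}`
    (∀ j : Fin (d + 1), ∃! Dj : LinearMap.BilinForm 𝓀[F]
        (StronglyRamified.W L (StronglyRamified.fieldOf F V (γ j.castSucc))
          (StronglyRamified.fieldOf F V (γ j.succ)) (r j)),
      StronglyRamified.IsTraceForm L (StronglyRamified.fieldOf F V (γ j.castSucc))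
        (StronglyRamified.fieldOf F V (γ j.succ)) (r j) h
        (StronglyRamified.emb F V (((y⁻¹ : Eˣ) : E) * ϖ))
        (StronglyRamified.emb F V (γ j.castSucc - γ j.succ)) Dj) ∧
    -- and `D = D_0 ⊥ … ⊥ D_d` is symmetric and non-degenerate, as a bilinear form and as a
    -- quadratic form
    ∀ D : ∀ j : Fin (d + 1), LinearMap.BilinForm 𝓀[F]
        (StronglyRamified.W L (StronglyRamified.fieldOf F V (γ j.castSucc))
          (StronglyRamified.fieldOf F V (γ j.succ)) (r j)),
      (∀ j, StronglyRamified.IsTraceForm L (StronglyRamified.fieldOf F V (γ j.castSucc))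
        (StronglyRamified.fieldOf F V (γ j.succ)) (r j) h
        (StronglyRamified.emb F V (((y⁻¹ : Eˣ) : E) * ϖ))
        (StronglyRamified.emb F V (γ j.castSucc - γ j.succ)) (D j)) →
      (StronglyRamified.orthogonalSum D).IsSymm ∧
      (StronglyRamified.orthogonalSum D).Nondegenerate ∧
      (StronglyRamified.orthogonalSum D).toQuadraticMap.polarBilin.Nondegenerate := by
  let c' : F →+* F := ((c : F ≃+* F) : F →+* F)
  have hc' : Function.Surjective c' := c.surjective
  have hh : h.SeparatingRight := hnd.2
  have hV : Module.finrank E V = 1 := by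
    have h1 := Module.finrank_mul_finrank F E V
    rw [hdim] at h1
    exact Nat.eq_of_mul_eq_mul_left Module.finrank_pos (by rw [h1, mul_one])
  have : Nontrivial V := Module.nontrivial_of_finrank_pos (R := E) (by omega)
  have hcc := StronglyRamified.involutive_of_hermitian hh hε hherm
  have hcval : ∀ a, valuation F a ≤ 1 → valuation F (c' a - a) < 1 := fun a ha =>
    StronglyRamified.val_algHom_sub_lt_one hF hFram (c : F →ₐ[F₀] F) ha
  have hpure : ∀ x : E, x ≠ 0 → ∃ m : ℤ, ∀ k,
      (L.toFun k).map ((StronglyRamified.emb F V x).restrictScalars 𝒪[F]) = L.toFun (k + m) := by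
    intro x hx
    refine hsimple.isPure _ ?_ ?_
    · rw [bot_sup_eq, ← Set.image_singleton, ← AlgHom.map_adjoin, hβ]
      exact ⟨x, Algebra.mem_top, rfl⟩
    · rw [Ne, map_eq_zero_iff _ StronglyRamified.emb_injective]
      exact hx
  obtain ⟨w, -, hw⟩ := StronglyRamified.exists_isGenerator hV L hpure hϖ
  obtain ⟨b, hb, hb'⟩ := StronglyRamified.exists_val_trace_eq_one F E htame
  obtain ⟨σ, hσ, hσσ⟩ := StronglyRamified.exists_conj_emb hc' hh hε hherm hβ
    (by rw [← happrox.zero]; exact hskew 0)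
  have hfix : ∀ x, x ∈ (algebraMap E₀ E).range ↔ σ x = x := by
    intro x
    rw [hE₀, StronglyRamified.alpha, neg_neg, hσ, StronglyRamified.emb_injective.eq_iff]
  have h2F : valuation F (2 : F) = 1 := by
    have h1 := StronglyRamified.val_natCast_eq_one F₀ (p := 2) fun hdvd =>
      ((Nat.dvd_prime Nat.prime_two).mp hdvd).elim CharP.ringChar_ne_one hodd
    rw [← StronglyRamified.val_algebraMap_eq_one_iff (L := F), map_natCast,
      Nat.cast_ofNat] at h1
    exact h1
  have h2E : (2 : E) ≠ 0 := by
    intro h0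
    have h1 : algebraMap F E 2 = 0 := by rw [map_ofNat, h0]
    rw [map_eq_zero] at h1
    rw [h1, map_zero] at h2F
    exact zero_ne_one h2F
  have hyN : valuation E ((orderOf y : ℕ) : E) = 1 := by
    have h1 := StronglyRamified.val_natCast_eq_one F
      (StronglyRamified.ringChar_residueField_not_dvd hyp)
    rw [← StronglyRamified.val_algebraMap_eq_one_iff (L := E)] at h1
    simpa using h1
  have hy1 : (y : E) ^ orderOf y = 1 := by
    rw [← Units.val_pow_eq_pow_val, pow_orderOf_eq_one, Units.val_one]
  have hN0 : orderOf y ≠ 0 := hy.orderOf_pos.ne'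
  have hσy := StronglyRamified.conj_rootOfUnity hE σ hfix hEram hN0 hy1 hyN
  have hvy : valuation E (y : E) = 1 := by
    have h1 := congrArg (valuation E) hy1
    rw [map_pow, map_one] at h1
    exact (pow_eq_one_iff.mp h1).resolve_right hN0
  have hσϖ := StronglyRamified.conj_eq_neg_of_sq_eq_neg_norm hE σ hσσ hfix h2E
    (StronglyRamified.irreducible_coe_ne_zero hϖ) hϖN
  have hu : valuation E (((y⁻¹ : Eˣ) : E) * ϖ) = valuation E (ϖ : E) := by
    rw [map_mul, Units.val_inv_eq_inv_val, map_inv₀, hvy, inv_one, one_mul]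
  -- The root of unity `y` is fixed and `ϖ` changes sign, so `y⁻¹ϖ` is skew: this makes `D`
  -- symmetric rather than alternating.
  have hubar : StronglyRamified.conjAdjoint h (StronglyRamified.emb F V (((y⁻¹ : Eˣ) : E) * ϖ)) =
      -StronglyRamified.emb F V (((y⁻¹ : Eˣ) : E) * ϖ) := by
    rw [hσ, map_mul, Units.val_inv_eq_inv_val, map_inv₀, hσy, hσϖ, mul_neg, map_neg]
  have hsymm := fun j : Fin (d + 1) => StronglyRamified.isSymmIntegral hc' hh hε hherm hcc hw hϖ
    hself hcval hu hubar (hskew j.castSucc) (hskew j.succ) (happrox.tower j) (happrox.equiv j)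
  refine ⟨fun j => (hsymm j).existsUnique_isTraceForm, fun D hD => ?_⟩
  refine StronglyRamified.orthogonalSum_nondegenerate
    (fun j => (hsymm j).isTraceForm_symm (hD j))
    (fun j => (hsymm j).isTraceForm_separating (hD j) fun X hX hXY => ?_) ?_
  · exact StronglyRamified.mem_wDen_of_forall_val_lt_one hc' hh hε hherm hcc hw hϖ hself hcval hu
      (hskew j.succ) (happrox.tower j) (happrox.equiv j) hb hb' (happrox.crit_or j) hX hXY
  · intro h0
    have h1 : IsLocalRing.residue 𝒪[F] 2 = 0 := by rw [map_ofNat, h0]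
    rw [IsLocalRing.residue_eq_zero_iff, StronglyRamified.mem_maximalIdeal_iff] at h1
    exact h1.ne h2F
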